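/- **Setting.** Let $\mathfrak H$ be a real separable Hilbert space with complexification $\mathfrak H_{\mathbb C}=\{f+\mathrm i g: f,g\in\mathfrak H\}$. Let $X=\{X(h):h\in\mathfrak H\}$ and $Y=\{Y(h):h\in\mathfrak H\}$ be independent isonormal Gaussian processes over $\mathfrak H$ on a probability space $(\Omega,\mathcal F,P)$; that is, each is a centered Gaussian family, with $E[X(g)X(h)]=E[Y(g)Y(h)]=\langle g,h\rangle_{\mathfrak H}$. For $\mathfrak h=f+\mathrm i g\in\mathfrak H_{\mathbb C}$ put $$Z(\mathfrak h)=\tfrac1{\sqrt2}\big(X(f)+\mathrm iX(g)+\mathrm i\,(Y(f)+\mathrm iY(g))\big),$$ and let $W(h,f)=X(h)+Y(f)$, an isonormal Gaussian process over the Hilbert space direct sum $\mathfrak H\oplus\mathfrak H$. Symmetric tensor powers $\odot$ are closed subspaces of the Hilbert space tensor powers, and $\mathrm{symm}$ is the average over all permutations of the factors. *Real multiple integral.* Let $H_k(x)=(-1)^k e^{x^2/2}\frac{d^k}{dx^k}e^{-x^2/2}$. For $u\in(\mathfrak H\oplus\mathfrak H)^{\odot p}$, $\mathcal I_p(u)\in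 L^2(\Omega)$ is the real multiple Wiener–Itô integral with respect to $W$: the continuous linear map determined, for an orthonormal basis $(c_k)$ of $\mathfrak H\oplus\mathfrak H$, by $$\mathcal I_p\big(\mathrm{symm}(\textstyle\bigotimes_k c_k^{\otimes p_k})\big)=\prod_k H_{p_k}(W(c_k)),\qquad \sum_k p_k=p .$$ *Complex multiple integral.* Let $J_{m,n}(z)=2^{m+n}(\partial^*)^m(\bar\partial^*)^n1$, where $(\partial^*\phi)(z)=-\frac{\partial\phi}{\partial\bar z}(z)+\frac z2\phi(z)$ and $(\bar\partial^*\phi)(z)=-\frac{\partial\phi}{\partial z}(z)+\frac{\bar z}2\phi(z)$. For $\varphi\in\mathfrak H_{\mathbb C}^{\odot m}\otimes\mathfrak H_{\mathbb C}^{\odot n}$, $\mathscr I_{m,n}(\varphi)\in L^2_{\mathbb C}(\Omega)$ is the complex multiple Wiener–Itô integral with respect to $Z$: the continuous linear map determined, for an orthonormal basis $(\mathfrak e_k)$ of $\mathfrak H_{\mathbb C}$, by $$\mathscr I_{m,n}\big(\mathrm{symm}(\textstyle\bigotimes_k\mathfrak e_k^{\otimes m_k})\otimes\mathrm{symm}(\bigotimes_k\bar{\mathfrak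 e}_k^{\otimes n_k})\big)=\prod_k 2^{-(m_k+n_k)/2}J_{m_k,n_k}(\sqrt2\,Z(\mathfrak e_k)),\qquad \sum_k m_k=m,\ \sum_k n_k=n .$$ Neither integral depends on the choice of the orthonormal basis. **Theorem.** Let $m,n\ge0$, $\varphi\in\mathfrak H_{\mathbb C}^{\odot m}\otimes\mathfrak H_{\mathbb C}^{\odot n}$, and $F=\mathscr I_{m,n}(\varphi)=U+\mathrm iV$ with $U,V$ real. Then there exist real $u,v\in(\mathfrak H\oplus\mathfrak H)^{\odot(m+n)}$ such that $$U=\mathcal I_{m+n}(u),\qquad V=\mathcal I_{m+n}(v)\qquad\text{almost surely},$$ and if $m\ne n$, then in addition $$E[U^2]=E[V^2],\qquad E[UV]=(m+n)!\,\langle u,v\rangle_{(\mathfrak H\oplus\mathfrak H)^{\otimes(m+n)}}=0 .$$ -/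

import Mathlib

open MeasureTheory ProbabilityTheory

noncomputable section

namespace WienerIto

open scoped TensorProduct Matrix ComplexOrder

/-! ### The inner product on the algebraic tensor power -/

/-- The algebraic tensor power `H^{⊗ι}` of a Hilbert space (factors indexed by the finite type `ι`). -/
def AlgTensor (𝕜 H ι : Type*) [RCLike 𝕜] [NormedAddCommGroup H] [InnerProductSpace 𝕜 H] :=
  ⨂[𝕜] _ : ι, H

namespace AlgTensor

variable {𝕜 H ι : Type*} [RCLike 𝕜] [NormedAddCommGroup H] [InnerProductSpace 𝕜 H]

instance instAddCommGroup : AddCommGroup (AlgTensor 𝕜 H ι) :=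
  inferInstanceAs (AddCommGroup (⨂[𝕜] _ : ι, H))
instance instModule : Module 𝕜 (AlgTensor 𝕜 H ι) := inferInstanceAs (Module 𝕜 (⨂[𝕜] _ : ι, H))

/-- The elementary tensor `⊗ᵢ fᵢ`. -/
def tprod (f : ι → H) : AlgTensor 𝕜 H ι := PiTensorProduct.tprod 𝕜 f

lemma exists_sum (x : AlgTensor 𝕜 H ι) :
    ∃ (n : ℕ) (c : Fin n → 𝕜) (f : Fin n → ι → H), x = ∑ a, c a • tprod (f a) := by
  have hs : Submodule.span 𝕜 (Set.range (tprod : (ι → H) → AlgTensor 𝕜 H ι)) = ⊤ :=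
    PiTensorProduct.span_tprod_eq_top
  have hx : x ∈ Submodule.span 𝕜 (Set.range (tprod : (ι → H) → AlgTensor 𝕜 H ι)) := by
    rw [hs]; trivial
  obtain ⟨n, c, g, h⟩ := Submodule.mem_span_set'.mp hx
  choose f hf using fun a => (g a).2
  exact ⟨n, c, f, by rw [← h]; exact Finset.sum_congr rfl fun a _ => by rw [← hf a]⟩

variable [Fintype ι]

/-- The linear form `⊗ᵢ gᵢ ↦ ∏ᵢ ⟪fᵢ, gᵢ⟫`. -/
def innerForm (f : ι → H) : AlgTensor 𝕜 H ι →ₗ[𝕜] 𝕜 :=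
  PiTensorProduct.lift ((MultilinearMap.mkPiAlgebra 𝕜 ι 𝕜).compLinearMap fun i => innerₛₗ 𝕜 (f i))

@[simp] lemma innerForm_tprod (f g : ι → H) :
    innerForm f (tprod g : AlgTensor 𝕜 H ι) = ∏ i, inner 𝕜 (f i) (g i) := by
  refine (PiTensorProduct.lift.tprod _).trans ?_
  simp

lemma innerForm_update_add [DecidableEq ι] (f : ι → H) (i : ι) (x y : H) :
    (innerForm (Function.update f i (x + y)) : AlgTensor 𝕜 H ι →ₗ[𝕜] 𝕜)
      = innerForm (Function.update f i x) + innerForm (Function.update f i y) := by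
  refine PiTensorProduct.ext (MultilinearMap.ext fun g => ?_)
  change innerForm _ (tprod g : AlgTensor 𝕜 H ι) =
    innerForm _ (tprod g : AlgTensor 𝕜 H ι) + innerForm _ (tprod g : AlgTensor 𝕜 H ι)
  simp only [innerForm_tprod]
  have key (z : H) : ∏ j, inner 𝕜 (Function.update f i z j) (g j)
      = (inner 𝕜 z (g i) : 𝕜) * ∏ j ∈ Finset.univ.erase i, inner 𝕜 (f j) (g j) := by
    rw [← Finset.mul_prod_erase _ _ (Finset.mem_univ i), Function.update_self]
    congr 1
    exact Finset.prod_congr rfl fun j hj => by rw [Function.update_of_ne (Finset.ne_of_mem_erase hj)]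
  rw [key, key, key, inner_add_left, add_mul]

lemma innerForm_update_smul [DecidableEq ι] (f : ι → H) (i : ι) (c : 𝕜) (x : H) :
    (innerForm (Function.update f i (c • x)) : AlgTensor 𝕜 H ι →ₗ[𝕜] 𝕜)
      = (starRingEnd 𝕜 c) • innerForm (Function.update f i x) := by
  refine PiTensorProduct.ext (MultilinearMap.ext fun g => ?_)
  change innerForm _ (tprod g : AlgTensor 𝕜 H ι) =
    (starRingEnd 𝕜 c) • innerForm _ (tprod g : AlgTensor 𝕜 H ι)
  simp only [innerForm_tprod]
  have key (z : H) : ∏ j, inner 𝕜 (Function.update f i z j) (g j)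
      = (inner 𝕜 z (g i) : 𝕜) * ∏ j ∈ Finset.univ.erase i, inner 𝕜 (f j) (g j) := by
    rw [← Finset.mul_prod_erase _ _ (Finset.mem_univ i), Function.update_self]
    congr 1
    exact Finset.prod_congr rfl fun j hj => by rw [Function.update_of_ne (Finset.ne_of_mem_erase hj)]
  rw [key, key, inner_smul_left, smul_eq_mul, mul_assoc]

/-- The sesquilinear form, written as a map linear in the second variable of the inner product. -/
def innerAux : AlgTensor 𝕜 H ι →ₗ[𝕜] (AlgTensor 𝕜 H ι →ₗ⋆[𝕜] 𝕜) :=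
  PiTensorProduct.lift
    { toFun := fun g =>
        { toFun := fun x => starRingEnd 𝕜 (innerForm g x)
          map_add' := fun x y => by rw [map_add, map_add]
          map_smul' := fun c x => by rw [map_smul, smul_eq_mul, map_mul, smul_eq_mul] }
      map_update_add' := fun f i x y => by
        ext z; simp [innerForm_update_add]
      map_update_smul' := fun f i c x => by
        ext z; simp [innerForm_update_smul] }

lemma innerAux_tprod (g : ι → H) (x : AlgTensor 𝕜 H ι) :
    innerAux (tprod g) x = starRingEnd 𝕜 (innerForm g x) := by
  exact DFunLike.congr_fun (PiTensorProduct.lift.tprod (R := 𝕜) g) x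

lemma innerAux_tprod_tprod (f g : ι → H) :
    innerAux (tprod g) (tprod f : AlgTensor 𝕜 H ι) = ∏ i, inner 𝕜 (f i) (g i) := by
  simp [innerAux_tprod]

lemma posSemidef_prod_inner {n : ℕ} (f : Fin n → ι → H) :
    (Matrix.of fun a b => ∏ i, inner 𝕜 (f a i) (f b i) : Matrix (Fin n) (Fin n) 𝕜).PosSemidef := by
  classical
  have key (s : Finset ι) :
      (Matrix.of fun a b => ∏ i ∈ s, inner 𝕜 (f a i) (f b i) :
        Matrix (Fin n) (Fin n) 𝕜).PosSemidef := by
    induction s using Finset.induction_on with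
    | empty =>
      have h := Matrix.posSemidef_gram 𝕜 (fun _ : Fin n => (1 : 𝕜))
      convert h using 1
      ext a b
      simp [Matrix.gram]
    | insert i s hi ih =>
      have h := (Matrix.posSemidef_gram 𝕜 (fun a => f a i)).hadamard ih
      convert h using 1
      ext a b
      simp [Matrix.gram, Finset.prod_insert hi]
  exact key Finset.univ

/-- The inner product of the algebraic tensor power, `⟪⊗ᵢ fᵢ, ⊗ᵢ gᵢ⟫ = ∏ᵢ ⟪fᵢ, gᵢ⟫`. -/
@[reducible] def core : PreInnerProductSpace.Core 𝕜 (AlgTensor 𝕜 H ι) where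
  inner x y := innerAux y x
  conj_inner_symm x y := by
    obtain ⟨n, c, f, rfl⟩ := exists_sum x
    obtain ⟨m, d, g, rfl⟩ := exists_sum y
    simp only [map_sum, LinearMap.sum_apply, map_smul, LinearMap.map_smulₛₗ, LinearMap.smul_apply,
      innerAux_tprod_tprod, smul_eq_mul, map_mul, map_prod, inner_conj_symm, RCLike.conj_conj]
    simp only [Finset.mul_sum]
    rw [Finset.sum_comm]
    refine Finset.sum_congr rfl fun a _ => Finset.sum_congr rfl fun b _ => ?_
    ring
  re_inner_nonneg x := by
    obtain ⟨n, c, f, rfl⟩ := exists_sum x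
    have h := (posSemidef_prod_inner (𝕜 := 𝕜) f).re_dotProduct_nonneg c
    convert h using 2
    simp only [map_sum, LinearMap.sum_apply, map_smul, LinearMap.map_smulₛₗ, LinearMap.smul_apply,
      innerAux_tprod_tprod, smul_eq_mul, dotProduct, Matrix.mulVec, Matrix.of_apply,
      Finset.mul_sum, Pi.star_apply, RCLike.star_def]
    refine Finset.sum_congr rfl fun a _ => Finset.sum_congr rfl fun b _ => ?_
    ring
  add_left x y z := map_add _ _ _
  smul_left x y c := by rw [LinearMap.map_smulₛₗ, smul_eq_mul]

instance : SeminormedAddCommGroup (AlgTensor 𝕜 H ι) :=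
  letI := core (𝕜 := 𝕜) (H := H) (ι := ι)
  InnerProductSpace.Core.toSeminormedAddCommGroup (𝕜 := 𝕜)

instance : InnerProductSpace 𝕜 (AlgTensor 𝕜 H ι) := InnerProductSpace.ofCore core

lemma inner_tprod_tprod (f g : ι → H) :
    inner 𝕜 (tprod f : AlgTensor 𝕜 H ι) (tprod g) = ∏ i, inner 𝕜 (f i) (g i) :=
  innerAux_tprod_tprod f g

end AlgTensor

/-! ### Complexification and Hilbert tensor powers -/

/-- The complexification `H_ℂ = {f + i g : f, g ∈ H}`, with norm `‖f + i g‖² = ‖f‖² + ‖g‖²`. -/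
def Complexification (H : Type*) := WithLp 2 (H × H)

namespace Complexification

variable {H : Type*}

/-- `f + i g`. -/
def mk (f g : H) : Complexification H := WithLp.toLp 2 (f, g)
/-- `f`, for `f + i g`. -/
def re (h : Complexification H) : H := WithLp.fst h
/-- `g`, for `f + i g`. -/
def im (h : Complexification H) : H := WithLp.snd h

@[simp] lemma re_mk (f g : H) : (mk f g).re = f := rfl
@[simp] lemma im_mk (f g : H) : (mk f g).im = g := rfl

@[ext] lemma ext {h k : Complexification H} (h₁ : h.re = k.re) (h₂ : h.im = k.im) : h = k :=
  (WithLp.ofLp_injective 2) (Prod.ext h₁ h₂)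

variable [NormedAddCommGroup H]

instance instNormedAddCommGroup : NormedAddCommGroup (Complexification H) :=
  inferInstanceAs (NormedAddCommGroup (WithLp 2 (H × H)))

@[simp] lemma re_add (h k : Complexification H) : (h + k).re = h.re + k.re := rfl
@[simp] lemma im_add (h k : Complexification H) : (h + k).im = h.im + k.im := rfl
@[simp] lemma re_zero : (0 : Complexification H).re = 0 := rfl
@[simp] lemma im_zero : (0 : Complexification H).im = 0 := rfl

lemma norm_sq (h : Complexification H) : ‖h‖ ^ 2 = ‖h.re‖ ^ 2 + ‖h.im‖ ^ 2 :=
  WithLp.prod_norm_sq_eq_of_L2 (show WithLp 2 (H × H) from h)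

variable [InnerProductSpace ℝ H]

instance instSMul : SMul ℂ (Complexification H) where
  smul c h := mk (c.re • h.re - c.im • h.im) (c.re • h.im + c.im • h.re)

@[simp] lemma re_smul (c : ℂ) (h : Complexification H) :
    (c • h).re = c.re • h.re - c.im • h.im := rfl
@[simp] lemma im_smul (c : ℂ) (h : Complexification H) :
    (c • h).im = c.re • h.im + c.im • h.re := rfl

instance instModule : Module ℂ (Complexification H) where
  one_smul h := by ext <;> simp
  mul_smul a b h := by ext <;> simp <;> module
  smul_zero a := by ext <;> simp
  smul_add a h k := by ext <;> simp <;> module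
  add_smul a b h := by ext <;> simp <;> module
  zero_smul h := by ext <;> simp

instance instInnerProductSpace : InnerProductSpace ℂ (Complexification H) where
  inner h k := ⟨inner ℝ h.re k.re + inner ℝ h.im k.im, inner ℝ h.re k.im - inner ℝ h.im k.re⟩
  norm_smul_le c h := by
    refine le_of_eq ((sq_eq_sq₀ (norm_nonneg _) (by positivity)).mp ?_)
    rw [norm_sq, mul_pow, norm_sq, Complex.sq_norm, Complex.normSq_apply, re_smul, im_smul,
      norm_sub_sq_real, norm_add_sq_real]
    simp only [norm_smul, inner_smul_left, inner_smul_right, mul_pow, Real.norm_eq_abs, sq_abs,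
      conj_trivial, real_inner_comm h.re h.im]
    ring
  norm_sq_eq_re_inner h := by
    rw [norm_sq, ← real_inner_self_eq_norm_sq, ← real_inner_self_eq_norm_sq]; rfl
  conj_inner_symm h k := by
    apply Complex.ext
    · simp [real_inner_comm]
    · simp [real_inner_comm]
  add_left h k l := by
    apply Complex.ext
    · simp [inner_add_left]; ring
    · simp [inner_add_left]; ring
  smul_left h k c := by
    apply Complex.ext
    · simp [inner_add_left, inner_sub_left, inner_smul_left]; ring
    · simp [inner_add_left, inner_sub_left, inner_smul_left]; ring

/-- Complex conjugation `f + i g ↦ f - i g`. -/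
def conj (h : Complexification H) : Complexification H := mk h.re (-h.im)

end Complexification

section Tensor

variable (𝕜 H : Type*) [RCLike 𝕜] [NormedAddCommGroup H] [InnerProductSpace 𝕜 H]

/-- The Hilbert space tensor power `H^{⊗ι}`: the completion of the algebraic one. -/
abbrev HilbertTensor (ι : Type*) [Fintype ι] := UniformSpace.Completion (AlgTensor 𝕜 H ι)

variable {H}

/-- The elementary tensor `⊗ᵢ fᵢ` in the Hilbert space tensor power. -/
def tensor {ι : Type*} [Fintype ι] (f : ι → H) : HilbertTensor 𝕜 H ι :=
  ((AlgTensor.tprod f : AlgTensor 𝕜 H ι) : UniformSpace.Completion (AlgTensor 𝕜 H ι))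

/-- The symmetrization `symm(f₁ ⊗ ⋯ ⊗ fₘ) = (1/m!) ∑_σ f_{σ(1)} ⊗ ⋯ ⊗ f_{σ(m)}`. -/
def symmTensor {m : ℕ} (f : Fin m → H) : HilbertTensor 𝕜 H (Fin m) :=
  (m.factorial : 𝕜)⁻¹ • ∑ σ : Equiv.Perm (Fin m), tensor 𝕜 (f ∘ σ)

/-- `symm(f₁ ⊗ ⋯ ⊗ fₘ) ⊗ symm(g₁ ⊗ ⋯ ⊗ gₙ)`, as an element of `H^{⊗(m+n)}`. -/
def symmTensorTensor {m n : ℕ} (f : Fin m → H) (g : Fin n → H) :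
    HilbertTensor 𝕜 H (Fin m ⊕ Fin n) :=
  ((m.factorial * n.factorial : ℕ) : 𝕜)⁻¹ • ∑ σ : Equiv.Perm (Fin m), ∑ τ : Equiv.Perm (Fin n),
    tensor 𝕜 (Sum.elim (f ∘ σ) (g ∘ τ))

variable (H)

/-- The symmetric tensor power `H^{⊙m}`, a closed subspace of `H^{⊗m}`. -/
def SymPower (m : ℕ) : Submodule 𝕜 (HilbertTensor 𝕜 H (Fin m)) :=
  (Submodule.span 𝕜 (Set.range fun f : Fin m → H => symmTensor 𝕜 f)).topologicalClosure

/-- The Hilbert space tensor product `H^{⊙m} ⊗ H^{⊙n}`, a closed subspace of `H^{⊗(m+n)}`. -/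
def SymPowerTensor (m n : ℕ) : Submodule 𝕜 (HilbertTensor 𝕜 H (Fin m ⊕ Fin n)) :=
  (Submodule.span 𝕜 (Set.range fun p : (Fin m → H) × (Fin n → H) =>
    symmTensorTensor 𝕜 p.1 p.2)).topologicalClosure

end Tensor

/-! ### Complex Hermite polynomials -/

/-- The Wirtinger derivative `∂f/∂z = ½ (∂f/∂x - i ∂f/∂y)`. -/
def wirtinger (f : ℂ → ℂ) (z : ℂ) : ℂ :=
  (1 / 2) * (fderiv ℝ f z 1 - Complex.I * fderiv ℝ f z Complex.I)

/-- The Wirtinger derivative `∂f/∂z̄ = ½ (∂f/∂x + i ∂f/∂y)`. -/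
def wirtingerBar (f : ℂ → ℂ) (z : ℂ) : ℂ :=
  (1 / 2) * (fderiv ℝ f z 1 + Complex.I * fderiv ℝ f z Complex.I)

/-- The creation operator `(∂* f)(z) = -∂f/∂z̄ + (z / ρ) f(z)`. -/
def creation (ρ : ℝ) (f : ℂ → ℂ) (z : ℂ) : ℂ := -wirtingerBar f z + z / ρ * f z

/-- The creation operator `(∂̄* f)(z) = -∂f/∂z + (z̄ / ρ) f(z)`. -/
def creationBar (ρ : ℝ) (f : ℂ → ℂ) (z : ℂ) : ℂ := -wirtinger f z + starRingEnd ℂ z / ρ * f z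

/-- The complex Hermite polynomial `J_{m,n}(z, ρ) = ρ^{m+n} (∂*)^m (∂̄*)^n 1`. -/
def complexHermite (m n : ℕ) (ρ : ℝ) (z : ℂ) : ℂ :=
  (ρ : ℂ) ^ (m + n) * (creation ρ)^[m] ((creationBar ρ)^[n] fun _ => 1) z

/-- Value at `(z, z̄)` of a polynomial in two variables. -/
def evalConj (p : MvPolynomial (Fin 2) ℂ) (z : ℂ) : ℂ := MvPolynomial.eval ![z, starRingEnd ℂ z] p

lemma hasFDerivAt_evalConj (p : MvPolynomial (Fin 2) ℂ) (z : ℂ) :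
    HasFDerivAt (𝕜 := ℝ) (evalConj p)
      (evalConj (MvPolynomial.pderiv 0 p) z • ContinuousLinearMap.id ℝ ℂ +
        evalConj (MvPolynomial.pderiv 1 p) z • (Complex.conjCLE : ℂ →L[ℝ] ℂ)) z := by
  induction p using MvPolynomial.induction_on with
  | C a =>
    have h : evalConj (MvPolynomial.C a) = fun _ => a := by ext; simp [evalConj]
    rw [h]
    convert hasFDerivAt_const (𝕜 := ℝ) a z using 1
    ext <;> simp [evalConj]
  | add p q hp hq =>
    have h : evalConj (p + q) = fun w => evalConj p w + evalConj q w := by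
      ext; simp [evalConj]
    rw [h]
    refine (HasFDerivAt.add hp hq).congr_fderiv (ContinuousLinearMap.ext fun w => ?_)
    simp [evalConj]
    ring
  | mul_X p i hp =>
    have h : evalConj (p * MvPolynomial.X i) =
        fun w => evalConj p w * (![w, starRingEnd ℂ w] : Fin 2 → ℂ) i := by
      ext; simp [evalConj]
    rw [h]
    fin_cases i
    · refine (HasFDerivAt.mul hp (hasFDerivAt_id (𝕜 := ℝ) z)).congr_fderiv
        (ContinuousLinearMap.ext fun w => ?_)
      simp [evalConj, MvPolynomial.pderiv_X]
      ring
    · refine (HasFDerivAt.mul hp (Complex.conjCLE : ℂ →L[ℝ] ℂ).hasFDerivAt).congr_fderiv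
        (ContinuousLinearMap.ext fun w => ?_)
      simp [evalConj, MvPolynomial.pderiv_X]
      ring

lemma wirtinger_evalConj (p : MvPolynomial (Fin 2) ℂ) :
    wirtinger (evalConj p) = evalConj (MvPolynomial.pderiv 0 p) := by
  ext z
  rw [wirtinger, (hasFDerivAt_evalConj p z).fderiv]
  simp
  linear_combination (-(1 / 2) * (evalConj (MvPolynomial.pderiv 0 p) z) +
    (1 / 2) * evalConj (MvPolynomial.pderiv 1 p) z) * Complex.I_mul_I

lemma wirtingerBar_evalConj (p : MvPolynomial (Fin 2) ℂ) :
    wirtingerBar (evalConj p) = evalConj (MvPolynomial.pderiv 1 p) := by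
  ext z
  rw [wirtingerBar, (hasFDerivAt_evalConj p z).fderiv]
  simp
  linear_combination ((1 / 2) * (evalConj (MvPolynomial.pderiv 0 p) z) -
    (1 / 2) * evalConj (MvPolynomial.pderiv 1 p) z) * Complex.I_mul_I

lemma creation_evalConj (ρ : ℝ) (p : MvPolynomial (Fin 2) ℂ) :
    creation ρ (evalConj p) = evalConj (-MvPolynomial.pderiv 1 p +
      MvPolynomial.C (ρ : ℂ)⁻¹ * MvPolynomial.X 0 * p) := by
  ext z
  rw [creation, wirtingerBar_evalConj]
  simp only [evalConj, map_add, map_neg, map_mul, MvPolynomial.eval_C, MvPolynomial.eval_X,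
    Matrix.cons_val_zero, Matrix.cons_val_one]
  ring

lemma creationBar_evalConj (ρ : ℝ) (p : MvPolynomial (Fin 2) ℂ) :
    creationBar ρ (evalConj p) = evalConj (-MvPolynomial.pderiv 0 p +
      MvPolynomial.C (ρ : ℂ)⁻¹ * MvPolynomial.X 1 * p) := by
  ext z
  rw [creationBar, wirtinger_evalConj]
  simp only [evalConj, map_add, map_neg, map_mul, MvPolynomial.eval_C, MvPolynomial.eval_X,
    Matrix.cons_val_zero, Matrix.cons_val_one]
  ring

/-- `J_{m,n}(z, ρ)` is a polynomial in `z` and `z̄`. -/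
lemma exists_complexHermite_eq (m n : ℕ) (ρ : ℝ) :
    ∃ p : MvPolynomial (Fin 2) ℂ, complexHermite m n ρ = evalConj p := by
  have h₁ : ∃ p, (creationBar ρ)^[n] (fun _ => 1) = evalConj p := by
    induction n with
    | zero => exact ⟨1, by ext; simp [evalConj]⟩
    | succ n ih =>
      obtain ⟨p, hp⟩ := ih
      exact ⟨_, by rw [Function.iterate_succ_apply', hp, creationBar_evalConj]⟩
  have h₂ : ∃ p, (creation ρ)^[m] ((creationBar ρ)^[n] fun _ => 1) = evalConj p := by
    induction m with
    | zero => exact h₁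
    | succ m ih =>
      obtain ⟨p, hp⟩ := ih
      exact ⟨_, by rw [Function.iterate_succ_apply', hp, creation_evalConj]⟩
  obtain ⟨p, hp⟩ := h₂
  exact ⟨MvPolynomial.C ((ρ : ℂ) ^ (m + n)) * p, by
    ext z; rw [complexHermite, hp]; simp [evalConj]⟩

/-! ### Isonormal Gaussian processes -/

section Isonormal

variable {Ω : Type*} [MeasurableSpace Ω] {P : Measure Ω}
variable {H : Type*} [NormedAddCommGroup H] [InnerProductSpace ℝ H]

/-- `X = {X(h) : h ∈ H}` is an isonormal Gaussian process over `H`: a centered Gaussian family with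
`E[X(g) X(h)] = ⟪g, h⟫`. -/
structure IsIsonormal (P : Measure Ω) (X : H → Ω → ℝ) : Prop where
  isGaussianProcess : IsGaussianProcess X P
  integral_eq_zero (h : H) : ∫ ω, X h ω ∂P = 0
  integral_mul (g h : H) : ∫ ω, X g ω * X h ω ∂P = inner ℝ g h

/-- The process `W(h, f) = X(h) + Y(f)` indexed by the Hilbert space direct sum `H ⊕ H`. -/
def directSumProcess (X Y : H → Ω → ℝ) (p : WithLp 2 (H × H)) (ω : Ω) : ℝ := X p.fst ω + Y p.snd ω

/-- If `X` and `Y` are independent, `W(h, f) = X(h) + Y(f)` is an isonormal Gaussian process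
over `H ⊕ H`. -/
lemma IsIsonormal.directSum {X Y : H → Ω → ℝ} (hX : IsIsonormal P X) (hY : IsIsonormal P Y)
    (hXY : IndepFun (fun ω h => X h ω) (fun ω h => Y h ω) P) :
    IsIsonormal P (directSumProcess X Y) := by
  have := hX.isGaussianProcess.isProbabilityMeasure
  have gX (h : H) : HasGaussianLaw (X h) P := hX.isGaussianProcess.hasGaussianLaw_eval h
  have gY (h : H) : HasGaussianLaw (Y h) P := hY.isGaussianProcess.hasGaussianLaw_eval h
  have cross (g h : H) : ∫ ω, X g ω * Y h ω ∂P = 0 := by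
    have hi : IndepFun (X g) (Y h) P :=
      hXY.comp (measurable_pi_apply g) (measurable_pi_apply h)
    rw [hi.integral_fun_mul_eq_mul_integral (gX g).aemeasurable.aestronglyMeasurable
      (gY h).aemeasurable.aestronglyMeasurable, hX.integral_eq_zero, zero_mul]
  refine ⟨⟨fun I => ?_⟩, fun p => ?_, fun p q => ?_⟩
  · classical
    have hi : IndepFun (fun ω => (I.image (WithLp.fst)).restrict (X · ω))
        (fun ω => (I.image (WithLp.snd)).restrict (Y · ω)) P :=
      hXY.comp (Finset.measurable_restrict (I.image WithLp.fst))
        (Finset.measurable_restrict (I.image WithLp.snd))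
    have hj := IndepFun.hasGaussianLaw (hX.isGaussianProcess.hasGaussianLaw _)
      (hY.isGaussianProcess.hasGaussianLaw _) hi
    let L : ((I.image (WithLp.fst (p := 2) (α := H) (β := H)) → ℝ) ×
        (I.image (WithLp.snd (p := 2) (α := H) (β := H)) → ℝ)) →L[ℝ] (I → ℝ) :=
      { toFun := fun x s => x.1 ⟨s.1.fst, Finset.mem_image_of_mem _ s.2⟩ +
          x.2 ⟨s.1.snd, Finset.mem_image_of_mem _ s.2⟩
        map_add' := fun x y => by ext s; simp; ring
        map_smul' := fun c x => by ext s; simp; ring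
        cont := by fun_prop }
    exact hj.map L
  · simp only [directSumProcess]
    rw [integral_add (gX _).integrable (gY _).integrable, hX.integral_eq_zero,
      hY.integral_eq_zero, add_zero]
  · have i₁ := (gX p.fst).memLp_two.integrable_mul (gX q.fst).memLp_two
    have i₂ := (gX p.fst).memLp_two.integrable_mul (gY q.snd).memLp_two
    have i₃ := (gY p.snd).memLp_two.integrable_mul (gX q.fst).memLp_two
    have i₄ := (gY p.snd).memLp_two.integrable_mul (gY q.snd).memLp_two
    have e : (fun ω => directSumProcess X Y p ω * directSumProcess X Y q ω) =
        ((X p.fst * X q.fst + X p.fst * Y q.snd) + (Y p.snd * X q.fst + Y p.snd * Y q.snd)) := by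
      ext ω; simp [directSumProcess]; ring
    rw [e, integral_add' (i₁.add i₂) (i₃.add i₄), integral_add' i₁ i₂, integral_add' i₃ i₄]
    simp only [Pi.mul_apply]
    rw [cross, hX.integral_mul, hY.integral_mul]
    have h₃ : ∫ ω, Y p.snd ω * X q.fst ω ∂P = 0 := by
      rw [← cross q.fst p.snd]; congr 1; ext ω; ring
    rw [h₃, WithLp.prod_inner_apply]
    simp

/-- The complex isonormal Gaussian process `Z(𝔥) = (X_ℂ(𝔥) + i Y_ℂ(𝔥)) / √2` over `H_ℂ`, where
`X_ℂ(f + i g) = X(f) + i X(g)` and likewise for `Y`. -/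
def complexProcess (X Y : H → Ω → ℝ) (h : Complexification H) (ω : Ω) : ℂ :=
  ((X h.re ω + Complex.I * X h.im ω) + Complex.I * (Y h.re ω + Complex.I * Y h.im ω)) / √2

/-! ### Moments -/

/-- All moments of `f` are finite. -/
def HasAllMoments {𝕜 : Type*} [RCLike 𝕜] (P : Measure Ω) (f : Ω → 𝕜) : Prop :=
  ∀ p : ENNReal, p ≠ ⊤ → MemLp f p P

namespace HasAllMoments

variable {𝕜 : Type*} [RCLike 𝕜] {f g : Ω → 𝕜}

lemma add (hf : HasAllMoments P f) (hg : HasAllMoments P g) :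
    HasAllMoments P fun ω => f ω + g ω := fun p hp => (hf p hp).add (hg p hp)

lemma mul (hf : HasAllMoments P f) (hg : HasAllMoments P g) :
    HasAllMoments P fun ω => f ω * g ω := fun p hp => by
  have : ENNReal.HolderTriple (2 * p) (2 * p) p := ⟨by
    rw [ENNReal.mul_inv (by simp) (by simp), ← add_mul, ENNReal.inv_two_add_inv_two, one_mul]⟩
  have h2 : 2 * p ≠ ⊤ := ENNReal.mul_ne_top (by simp) hp
  exact (hg _ h2).mul (hf _ h2)

variable [IsProbabilityMeasure P]

lemma const (c : 𝕜) : HasAllMoments P fun _ => c := fun p _ => memLp_const c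

lemma prod {ι : Type*} (s : Finset ι) {F : ι → Ω → 𝕜} (h : ∀ i ∈ s, HasAllMoments P (F i)) :
    HasAllMoments P fun ω => ∏ i ∈ s, F i ω := by
  classical
  induction s using Finset.induction_on with
  | empty => simpa using const 1
  | insert i s hi ih =>
    simp only [Finset.prod_insert hi]
    exact (h i (by simp)).mul (ih fun j hj => h j (by simp [hj]))

lemma aeval {R : Type*} [CommSemiring R] [Algebra R 𝕜] (p : Polynomial R)
    (hf : HasAllMoments P f) :
    HasAllMoments P fun ω => Polynomial.aeval (f ω) p := by
  induction p using Polynomial.induction_on' with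
  | add p q hp hq => simpa using hp.add hq
  | monomial n a =>
    have h : HasAllMoments P fun ω => f ω ^ n := by
      simpa using prod (Finset.range n) (F := fun _ => f) fun _ _ => hf
    simpa [Polynomial.aeval_monomial] using (const (algebraMap R 𝕜 a)).mul h

lemma evalConj {f : Ω → ℂ} (p : MvPolynomial (Fin 2) ℂ) (hf : HasAllMoments P f) :
    HasAllMoments P fun ω => evalConj p (f ω) := by
  have hc : HasAllMoments P fun ω => starRingEnd ℂ (f ω) := fun p hp => (hf p hp).star
  induction p using MvPolynomial.induction_on with
  | C a => simpa [WienerIto.evalConj] using const a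
  | add p q hp hq => simpa [WienerIto.evalConj] using hp.add hq
  | mul_X p i hp =>
    fin_cases i
    · simpa [WienerIto.evalConj] using hp.mul hf
    · simpa [WienerIto.evalConj] using hp.mul hc

end HasAllMoments

lemma IsIsonormal.hasAllMoments {X : H → Ω → ℝ} (hX : IsIsonormal P X) (h : H) :
    HasAllMoments P (X h) :=
  fun _ hp => (hX.isGaussianProcess.hasGaussianLaw_eval h).memLp hp

lemma hasAllMoments_complexProcess {X Y : H → Ω → ℝ} (hX : IsIsonormal P X)
    (hY : IsIsonormal P Y) (h : Complexification H) :
    HasAllMoments P (complexProcess X Y h) := by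
  have := hX.isGaussianProcess.isProbabilityMeasure
  have hofReal {f : Ω → ℝ} (hf : HasAllMoments P f) : HasAllMoments P fun ω => (f ω : ℂ) :=
    fun p hp => (hf p hp).ofReal
  have hI := HasAllMoments.const (P := P) Complex.I
  have key := (((hofReal (hX.hasAllMoments h.re)).add (hI.mul (hofReal (hX.hasAllMoments h.im)))).add
    (hI.mul ((hofReal (hY.hasAllMoments h.re)).add
      (hI.mul (hofReal (hY.hasAllMoments h.im)))))).mul
      (HasAllMoments.const (P := P) ((√2 : ℝ) : ℂ)⁻¹)
  have h₀ : complexProcess X Y h = fun ω => ((X h.re ω + Complex.I * X h.im ω) +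
      Complex.I * (Y h.re ω + Complex.I * Y h.im ω)) * ((√2 : ℝ) : ℂ)⁻¹ := by
    ext ω; rw [complexProcess, div_eq_mul_inv]
  rw [h₀]
  exact key

/-! ### Multiple Wiener-Itô integrals -/

open Classical in
/-- The multiplicity of `k` in the multi-index `i = (i₁, …, iₘ)`. -/
def indexCount {κ : Type*} {m : ℕ} (i : Fin m → κ) (k : κ) : ℕ :=
  (Finset.univ.filter fun a => i a = k).card

open Classical in
/-- The Fourier-Hermite polynomial `∏ₖ H_{mₖ}(X(eₖ))`, where `mₖ` is the multiplicity of `k` in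
`(i₁, …, iₘ)`; indices with `mₖ = 0` contribute the factor `H₀ = 1`. -/
def fourierHermite {κ : Type*} (X : H → Ω → ℝ) (e : κ → H) {m : ℕ} (i : Fin m → κ) (ω : Ω) : ℝ :=
  ∏ k ∈ Finset.univ.image i,
    Polynomial.aeval (X (e k) ω) (Polynomial.hermite (indexCount i k))

lemma memLp_fourierHermite {κ : Type*} {X : H → Ω → ℝ} (hX : IsIsonormal P X) (e : κ → H) {m : ℕ}
    (i : Fin m → κ) : MemLp (fourierHermite X e i) 2 P := by
  have := hX.isGaussianProcess.isProbabilityMeasure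
  exact HasAllMoments.prod _ (fun k _ => (hX.hasAllMoments (e k)).aeval _) 2 (by simp)

/-- The real multiple Wiener-Itô integral `I_m(u)` of `u ∈ H^{⊙m}` with respect to `X`: the
continuous linear extension of
`symm(e_{i₁} ⊗ ⋯ ⊗ e_{iₘ}) ↦ ∏ₖ H_{mₖ}(X(eₖ))`, `mₖ` the multiplicity of `k` in `(i₁, …, iₘ)`,
for an orthonormal basis `e` of `H`; that is, the `L²`-convergent sum obtained from the expansion
of `u` in the orthonormal basis `e_{i₁} ⊗ ⋯ ⊗ e_{iₘ}` of `H^{⊗m}`. -/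
def realIntegral {κ : Type*} {X : H → Ω → ℝ} (hX : IsIsonormal P X) (e : HilbertBasis κ ℝ H)
    (m : ℕ) (u : SymPower ℝ H m) : Lp ℝ 2 P :=
  ∑' i : Fin m → κ, (inner ℝ (tensor ℝ (e ∘ i)) (u : HilbertTensor ℝ H (Fin m)) : ℝ) •
    (memLp_fourierHermite hX e i).toLp (fourierHermite X e i)

open Classical in
/-- The complex Fourier-Hermite polynomial `∏ₖ 2^{-(mₖ+nₖ)/2} J_{mₖ,nₖ}(√2 Z(eₖ))`, where `mₖ`,
`nₖ` are the multiplicities of `k` in `(i₁, …, iₘ)` and in `(j₁, …, jₙ)`, and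
`J_{m,n}(z) = J_{m,n}(z, 2)`. -/
def complexFourierHermite {κ : Type*} (X Y : H → Ω → ℝ) (e : κ → Complexification H) {m n : ℕ}
    (i : Fin m → κ) (j : Fin n → κ) (ω : Ω) : ℂ :=
  ∏ k ∈ Finset.univ.image i ∪ Finset.univ.image j,
    ((√2 : ℂ) ^ (indexCount i k + indexCount j k))⁻¹ *
      complexHermite (indexCount i k) (indexCount j k) 2 (√2 * complexProcess X Y (e k) ω)

lemma memLp_complexFourierHermite {κ : Type*} {X Y : H → Ω → ℝ} (hX : IsIsonormal P X)
    (hY : IsIsonormal P Y) (e : κ → Complexification H) {m n : ℕ} (i : Fin m → κ)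
    (j : Fin n → κ) : MemLp (complexFourierHermite X Y e i j) 2 P := by
  have := hX.isGaussianProcess.isProbabilityMeasure
  refine HasAllMoments.prod _ (fun k _ => (HasAllMoments.const _).mul ?_) 2 (by simp)
  obtain ⟨p, hp⟩ := exists_complexHermite_eq (indexCount i k) (indexCount j k) 2
  rw [hp]
  exact ((HasAllMoments.const _).mul (hasAllMoments_complexProcess hX hY (e k))).evalConj p

/-- The complex multiple Wiener-Itô integral `I_{m,n}(φ)` of `φ ∈ H_ℂ^{⊙m} ⊗ H_ℂ^{⊙n}` with respect
to `Z`: the continuous linear extension of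
`symm(e_{i₁} ⊗ ⋯ ⊗ e_{iₘ}) ⊗ symm(ē_{j₁} ⊗ ⋯ ⊗ ē_{jₙ}) ↦ ∏ₖ 2^{-(mₖ+nₖ)/2} J_{mₖ,nₖ}(√2 Z(eₖ))`
for an orthonormal basis `e` of `H_ℂ`; that is, the `L²`-convergent sum obtained from the expansion
of `φ` in the orthonormal basis `e_{i₁} ⊗ ⋯ ⊗ e_{iₘ} ⊗ ē_{j₁} ⊗ ⋯ ⊗ ē_{jₙ}` of `H_ℂ^{⊗(m+n)}`. -/
def complexIntegral {κ : Type*} {X Y : H → Ω → ℝ} (hX : IsIsonormal P X) (hY : IsIsonormal P Y)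
    (e : HilbertBasis κ ℂ (Complexification H)) (m n : ℕ)
    (φ : SymPowerTensor ℂ (Complexification H) m n) : Lp ℂ 2 P :=
  ∑' ij : (Fin m → κ) × (Fin n → κ),
    (inner ℂ (tensor ℂ (Sum.elim (e ∘ ij.1) (Complexification.conj ∘ e ∘ ij.2)))
      (φ : HilbertTensor ℂ (Complexification H) (Fin m ⊕ Fin n)) : ℂ) •
    (memLp_complexFourierHermite hX hY e ij.1 ij.2).toLp (complexFourierHermite X Y e ij.1 ij.2)

end Isonormal

end WienerIto

end

open WienerIto

/-! Everything is computed with polynomials in formal variables `X h`, one for each vector `h` of `H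
⊕ H`, evaluated at the isonormal process `W`. On them act the annihilation derivations `D_v` with
`D_v X_w = ⟪v, w⟫` and the creation operators `X_v - D_v`. Iterated creation applied to `1` gives
Wick products. Gaussian integration by parts, `E[W(v) p] = E[D_v p]` (`expect_X_mul`), makes
creation the transpose of annihilation, so the expectation of a product of two Wick products of
equal degree is a permanent of covariances (`expect_wick_mul_wick`).

In the real case the permanent is `m!` times the inner product of symmetrized tensors. Hence
`symm(f)` ↦ Wick product of `f` extends to a map `T` on the symmetric power that multiplies inner
products by `m!` and has closed range (`exists_integral`, `isClosed_range_integral`). On an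
orthonormal basis the Hermite recursion turns Wick products into Fourier-Hermite polynomials, so `T`
is the real integral for every basis (`realIntegral_eq`).

In the complex case write `Z(h) = W(a) + i W(b)`, with conjugate `W(a) - i W(b)`. The complex
Fourier-Hermite polynomials are Wick products of `m` letters `Z` and `n` conjugate letters
(`complexFourierHermite_eq`). By multilinearity they are complex combinations of real Wick products
of degree `m + n`, so their real and imaginary parts lie in the range of `T`. Since that range is
closed, the same holds for the complex integral `F`, which yields `u` and `v`.

For `m ≠ n`, the bilinear covariance of two letters of the same kind is zero. A nonzero term of the
permanent for two words of type `(m, n)` must match the `m` plain letters of one with the `n`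
conjugate letters of the other, which is impossible (`sum_perm_cform_eq_zero`). Thus `E[F²] = 0`,
and its real and imaginary parts are the two moment identities. -/

noncomputable section

namespace WienerIto

open scoped TensorProduct Matrix ComplexOrder

/-! ### Wick products in an algebra with annihilation operators -/

/-- Expansion of a permanent along its first row. -/
lemma sum_perm_succ {R : Type*} [CommRing R] {n : ℕ} (M : Fin (n + 1) → Fin (n + 1) → R) :
    ∑ σ : Equiv.Perm (Fin (n + 1)), ∏ i, M i (σ i) =
      ∑ j, M 0 j * ∑ τ : Equiv.Perm (Fin n), ∏ i : Fin n, M i.succ (j.succAbove (τ i)) := by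
  -- A permutation of `Fin (n + 1)` is encoded by its value `j` at `0` and by the permutation that
  -- it induces between the remaining points and the complement of `j`.
  have hinj (p : Fin (n + 1) × Equiv.Perm (Fin n)) :
      Function.Injective (Fin.cons p.1 (p.1.succAbove ∘ p.2) : Fin (n + 1) → Fin (n + 1)) := by
    rw [Fin.cons_injective_iff]
    refine ⟨?_, Fin.succAbove_right_injective.comp p.2.injective⟩
    rintro ⟨i, hi⟩
    exact Fin.succAbove_ne _ _ hi
  let F : Fin (n + 1) × Equiv.Perm (Fin n) → Equiv.Perm (Fin (n + 1)) := fun p =>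
    Equiv.ofBijective _ (Finite.injective_iff_bijective.mp (hinj p))
  have hF : Function.Bijective F := by
    rw [Fintype.bijective_iff_injective_and_card]
    constructor
    · rintro ⟨j, τ⟩ ⟨j', τ'⟩ h
      have h' (i) := DFunLike.congr_fun h i
      have h0 : j = j' := by simpa [F] using h' 0
      subst h0
      congr 1
      ext i : 1
      simpa [F] using h' i.succ
    · simp [Fintype.card_perm, Nat.factorial_succ]
  rw [← hF.sum_comp, Fintype.sum_prod_type]
  refine Finset.sum_congr rfl fun j _ => ?_
  rw [Finset.mul_sum]
  refine Finset.sum_congr rfl fun τ _ => ?_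
  rw [Fin.prod_univ_succ]
  simp [F]

section Wick

variable {R A V : Type*} [CommRing R] [CommRing A] [Algebra R A]

/-- The creation operator `p ↦ x_v p - D_v p`. -/
def raise (x : V → A) (D : V → Derivation R A A) (v : V) : A →ₗ[R] A :=
  LinearMap.mulLeft R (x v) - (D v : A →ₗ[R] A)

lemma raise_apply (x : V → A) (D : V → Derivation R A A) (v : V) (p : A) :
    raise x D v p = x v * p - D v p := rfl

/-- The Wick product `:x_{f₁} ⋯ x_{fₘ}:`. -/
def wick (x : V → A) (D : V → Derivation R A A) : {m : ℕ} → (Fin m → V) → A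
  | 0, _ => 1
  | _ + 1, f => raise x D (f 0) (wick x D fun i => f i.succ)

variable {x : V → A} {D : V → Derivation R A A}

lemma wick_zero (f : Fin 0 → V) : wick x D f = 1 := rfl

lemma wick_succ {m : ℕ} (f : Fin (m + 1) → V) :
    wick x D f = raise x D (f 0) (wick x D fun i => f i.succ) := rfl

variable {B : V → V → R}

/-- Since `D v` kills `1`, moving it to the right through the creation operators leaves one
contraction for each factor that it passes. -/
lemma deriv_wick (hB : ∀ v w, D v (x w) = algebraMap R A (B v w))
    (hD : ∀ v w p, D v (D w p) = D w (D v p)) (v : V) {m : ℕ} (g : Fin (m + 1) → V) :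
    D v (wick x D g) = ∑ j, B v (g j) • wick x D fun i => g (j.succAbove i) := by
  -- The canonical commutation relation: the commutator of `D v` with creation at `w` is the scalar
  -- `B v w`.
  have comm (w : V) (p : A) : D v (raise x D w p) = B v w • p + raise x D w (D v p) := by
    simp only [raise_apply, map_sub, Derivation.leibniz, hB, hD v w, smul_eq_mul,
      Algebra.smul_def]
    ring
  induction m with
  | zero =>
    rw [wick_succ, comm, wick_zero]
    simp [wick_zero, raise_apply]
  | succ m ih =>
    rw [wick_succ, comm, ih, map_sum, Fin.sum_univ_succ (n := m + 1)]
    congr 1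
    refine Finset.sum_congr rfl fun j _ => ?_
    rw [map_smul, wick_succ]
    simp

/-- The covariance of two Wick products. -/
lemma expect_wick_mul_wick (hB : ∀ v w, D v (x w) = algebraMap R A (B v w))
    (hD : ∀ v w p, D v (D w p) = D w (D v p)) (ε : A →ₗ[R] R) (hε1 : ε 1 = 1)
    (hε : ∀ v p, ε (x v * p) = ε (D v p)) {m : ℕ} (f g : Fin m → V) :
    ε (wick x D f * wick x D g) = ∑ σ : Equiv.Perm (Fin m), ∏ i, B (f i) (g (σ i)) := by
  -- Creation is the transpose of annihilation for the pairing `ε (p * q)`. The pairing is bilinear,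
  -- without conjugation, so the result serves real covariances and complex pseudo-covariances
  -- alike.
  have adj (v : V) (p q : A) : ε (raise x D v p * q) = ε (p * D v q) := by
    have : raise x D v p * q = x v * (p * q) - q * D v p := by rw [raise_apply]; ring
    rw [this, map_sub, hε, Derivation.leibniz, map_add]
    simp
  induction m with
  | zero => simp [wick_zero, hε1]
  | succ m ih =>
    rw [wick_succ f, adj, deriv_wick hB hD, Finset.mul_sum, map_sum,
      sum_perm_succ fun i j => B (f i) (g j)]
    refine Finset.sum_congr rfl fun j _ => ?_
    rw [mul_smul_comm, map_smul, ih, smul_eq_mul]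

end Wick

/-! ### Gaussian integration by parts -/

lemma integrable_pow_gaussianReal (k : ℕ) : Integrable (fun x : ℝ => x ^ k) (gaussianReal 0 1) := by
  have h : HasAllMoments (𝕜 := ℝ) (gaussianReal 0 1) (id : ℝ → ℝ) :=
    fun p hp => memLp_id_gaussianReal' p hp
  have := HasAllMoments.aeval (R := ℝ) (Polynomial.X ^ k) h 1 (by simp)
  simpa using memLp_one_iff_integrable.mp this

/-- Integration by parts against the standard Gaussian density, whose derivative is `-x` times
itself. At `k = 0` the truncated exponent `k - 1` is harmless because of the factor `k`. -/
lemma integral_pow_succ_gaussianReal (k : ℕ) :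
    ∫ x, x ^ (k + 1) ∂(gaussianReal 0 1) = k * ∫ x, x ^ (k - 1) ∂(gaussianReal 0 1) := by
  have hI (k : ℕ) : Integrable fun x : ℝ => x ^ k * gaussianPDFReal 0 1 x := by
    have h := integrable_pow_gaussianReal k
    rw [gaussianReal_of_var_ne_zero _ one_ne_zero] at h
    rw [integrable_withDensity_iff (measurable_gaussianPDF _ _)
      (ae_of_all _ fun x => gaussianPDF_lt_top)] at h
    simpa [toReal_gaussianPDF] using h
  have hd (x : ℝ) : HasDerivAt (gaussianPDFReal 0 1) (-(x * gaussianPDFReal 0 1 x)) x := by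
    have h : HasDerivAt (fun x : ℝ => (√(2 * Real.pi * (1 : NNReal)))⁻¹ *
        Real.exp (-(x - 0) ^ 2 / (2 * (1 : NNReal)))) _ x :=
      (((((hasDerivAt_id x).sub_const 0).pow 2).neg.div_const _).exp.const_mul _)
    refine h.congr_deriv ?_
    rw [gaussianPDFReal]
    simp
    ring
  have key := integral_mul_deriv_eq_deriv_mul_of_integrable
    (u := fun x : ℝ => x ^ k) (u' := fun x => k * x ^ (k - 1)) (v := gaussianPDFReal 0 1)
    (v' := fun x => -(x * gaussianPDFReal 0 1 x))
    (fun x _ => hasDerivAt_pow k x) (fun x _ => hd x)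
    (by
      convert (hI (k + 1)).neg using 1
      ext x; simp; ring)
    (by
      convert (hI (k - 1)).const_mul (k : ℝ) using 1
      ext x; simp; ring)
    (hI k)
  rw [integral_gaussianReal_eq_integral_smul one_ne_zero,
    integral_gaussianReal_eq_integral_smul one_ne_zero, ← integral_const_mul]
  simp only [smul_eq_mul]
  have e₁ : (fun x : ℝ => gaussianPDFReal 0 1 x * x ^ (k + 1)) =
      fun x => -(x ^ k * -(x * gaussianPDFReal 0 1 x)) := by ext x; ring
  have e₂ : (fun x : ℝ => (k : ℝ) * (gaussianPDFReal 0 1 x * x ^ (k - 1))) =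
      fun x => k * x ^ (k - 1) * gaussianPDFReal 0 1 x := by ext x; ring
  rw [e₁, e₂, integral_neg, key, neg_neg]

section

variable {Ω : Type*} [MeasurableSpace Ω] {P : Measure Ω}
variable {H : Type*} [NormedAddCommGroup H] [InnerProductSpace ℝ H]
variable (𝕜 : Type*) [RCLike 𝕜]

/-- The annihilation operator of `h`: the derivation with `X_k ↦ ⟪h, k⟫`. -/
def annihilation (h : H) : Derivation 𝕜 (MvPolynomial H 𝕜) (MvPolynomial H 𝕜) :=
  MvPolynomial.mkDerivation 𝕜 fun k => MvPolynomial.C ((inner ℝ h k : ℝ) : 𝕜)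

@[simp] lemma annihilation_X (h k : H) :
    annihilation 𝕜 h (MvPolynomial.X k) = MvPolynomial.C ((inner ℝ h k : ℝ) : 𝕜) :=
  MvPolynomial.mkDerivation_X _ _ _

@[simp] lemma annihilation_C (h : H) (c : 𝕜) :
    annihilation 𝕜 h (MvPolynomial.C c) = 0 :=
  Derivation.map_algebraMap _ c

/-- The commutator of two derivations is a derivation, and here it vanishes on the variables because
each operator maps variables to constants. -/
lemma annihilation_comm (g h : H) (p : MvPolynomial H 𝕜) :
    annihilation 𝕜 g (annihilation 𝕜 h p) = annihilation 𝕜 h (annihilation 𝕜 g p) := by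
  have : ⁅annihilation 𝕜 g, annihilation 𝕜 h⁆ = 0 := by
    refine MvPolynomial.derivation_ext fun k => ?_
    simp [Derivation.commutator_apply]
  have := DFunLike.congr_fun this p
  rwa [Derivation.commutator_apply, Derivation.zero_apply, sub_eq_zero] at this

lemma annihilation_smul (t : ℝ) (h : H) (p : MvPolynomial H 𝕜) :
    annihilation 𝕜 (t • h) p = (t : 𝕜) • annihilation 𝕜 h p := by
  have : annihilation 𝕜 (t • h) = (t : 𝕜) • annihilation 𝕜 h := by
    refine MvPolynomial.derivation_ext fun k => ?_
    rw [Derivation.smul_apply, annihilation_X, annihilation_X, real_inner_smul_left,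
      RCLike.ofReal_mul, map_mul, MvPolynomial.smul_eq_C_mul]
  rw [this, Derivation.smul_apply]

variable {𝕜}

/-- The value of a polynomial in the variables `W(h)`. -/
def evalProcess (W : H → Ω → ℝ) (p : MvPolynomial H 𝕜) (ω : Ω) : 𝕜 :=
  MvPolynomial.eval (fun h => (W h ω : 𝕜)) p

lemma hasAllMoments_evalProcess {W : H → Ω → ℝ} (hW : IsIsonormal P W) (p : MvPolynomial H 𝕜) :
    HasAllMoments P (evalProcess W p) := by
  have := hW.isGaussianProcess.isProbabilityMeasure
  induction p using MvPolynomial.induction_on with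
  | C a =>
    have e : evalProcess W (MvPolynomial.C a) = fun _ => a := by ext; simp [evalProcess]
    exact e ▸ HasAllMoments.const a
  | add p q hp hq =>
    have e : evalProcess W (p + q) = fun ω => evalProcess W p ω + evalProcess W q ω := by
      ext; simp [evalProcess]
    exact e ▸ hp.add hq
  | mul_X p h hp =>
    have : HasAllMoments P fun ω => (W h ω : 𝕜) := fun p hp => (hW.hasAllMoments h p hp).ofReal
    have e : evalProcess W (p * MvPolynomial.X h) = fun ω => evalProcess W p ω * (W h ω : 𝕜) := by
      ext; simp [evalProcess]
    exact e ▸ hp.mul this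

lemma integrable_evalProcess {W : H → Ω → ℝ} (hW : IsIsonormal P W) (p : MvPolynomial H 𝕜) :
    Integrable (evalProcess W p) P :=
  memLp_one_iff_integrable.mp (hasAllMoments_evalProcess hW p 1 (by simp))

/-- The expectation of a polynomial in the variables `W(h)`. -/
def expect {W : H → Ω → ℝ} (hW : IsIsonormal P W) : MvPolynomial H 𝕜 →ₗ[𝕜] 𝕜 where
  toFun p := ∫ ω, evalProcess W p ω ∂P
  map_add' p q := by
    rw [← integral_add (integrable_evalProcess hW p) (integrable_evalProcess hW q)]
    simp [evalProcess]
  map_smul' c p := by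
    rw [RingHom.id_apply, smul_eq_mul, ← integral_const_mul]
    simp [evalProcess, MvPolynomial.smul_eq_C_mul]

lemma expect_apply {W : H → Ω → ℝ} (hW : IsIsonormal P W) (p : MvPolynomial H 𝕜) :
    expect hW p = ∫ ω, evalProcess W p ω ∂P := rfl

lemma expect_one {W : H → Ω → ℝ} (hW : IsIsonormal P W) :
    expect hW (1 : MvPolynomial H 𝕜) = 1 := by
  have := hW.isGaussianProcess.isProbabilityMeasure
  simp [expect_apply, evalProcess]

/-- An isonormal process is almost surely linear. -/
lemma IsIsonormal.smul_add_smul {W : H → Ω → ℝ} (hW : IsIsonormal P W) (a b : ℝ) (f g : H) :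
    W (a • f + b • g) =ᵐ[P] fun ω => a * W f ω + b * W g ω := by
  set p : MvPolynomial H ℝ := MvPolynomial.X (a • f + b • g) -
    a • MvPolynomial.X f - b • MvPolynomial.X g with hp
  have hX (h k : H) : expect hW (MvPolynomial.X h * MvPolynomial.X k : MvPolynomial H ℝ) =
      inner ℝ h k := by
    rw [← hW.integral_mul, expect_apply]
    simp [evalProcess]
  -- The second moment of `W(af + bg) - a W(f) - b W(g)` cancels by bilinearity of the covariance,
  -- so this nonnegative integrand is almost surely zero.
  have h0 : expect hW (p * p) = 0 := by
    simp only [hp, sub_mul, mul_sub, map_sub, smul_mul_assoc, mul_smul_comm, map_smul, hX,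
      inner_add_left, inner_add_right, inner_smul_left, inner_smul_right, smul_eq_mul]
    simp only [conj_trivial, real_inner_comm f g]
    ring
  have e : (fun ω => evalProcess W (p * p) ω) =
      fun ω => (W (a • f + b • g) ω - (a * W f ω + b * W g ω)) ^ 2 := by
    ext ω
    simp [evalProcess, hp]
    ring
  have hi := integrable_evalProcess hW (p * p)
  rw [expect_apply, e] at h0
  rw [show evalProcess W (p * p) = _ from e] at hi
  rw [integral_eq_zero_iff_of_nonneg (fun ω => sq_nonneg _) hi] at h0
  filter_upwards [h0] with ω hω
  exact sub_eq_zero.mp (pow_eq_zero_iff two_ne_zero |>.mp hω)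

/-- `W(h)` is standard normal and, being jointly Gaussian and uncorrelated with them, independent of
all `W(g)` with `g ⊥ h`. The expectation factors and the one-dimensional moment recursion applies.
-/
lemma expect_pow_succ_mul_rename {W : H → Ω → ℝ} (hW : IsIsonormal P W) {h : H} (hh : ‖h‖ = 1)
    (k : ℕ) (r : MvPolynomial {g : H // inner ℝ h g = 0} 𝕜) :
    expect hW (MvPolynomial.X h ^ (k + 1) * MvPolynomial.rename Subtype.val r :
        MvPolynomial H 𝕜) =
      (k : 𝕜) * expect hW (MvPolynomial.X h ^ (k - 1) * MvPolynomial.rename Subtype.val r) := by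
  have := hW.isGaussianProcess.isProbabilityMeasure
  have hindep : IndepFun (fun ω (_ : Unit) => W h ω)
      (fun ω (s : {g : H // inner ℝ h g = 0}) => W s ω) P := by
    refine IsGaussianProcess.indepFun_of_covariance_eq_zero (X := fun _ : Unit => W h)
      (Y := fun s : {g : H // inner ℝ h g = 0} => W s) ?_
      (fun _ => hW.isGaussianProcess.aemeasurable _)
      (fun _ => hW.isGaussianProcess.aemeasurable _) fun _ s => ?_
    · have e : Sum.elim (fun _ : Unit => W h) (fun s : {g : H // inner ℝ h g = 0} => W s) =
          W ∘ Sum.elim (fun _ : Unit => h) Subtype.val := by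
        ext (s | s) <;> rfl
      rw [e]
      exact hW.isGaussianProcess.comp_right _
    · rw [covariance_eq_sub (hW.hasAllMoments h 2 (by simp)) (hW.hasAllMoments s 2 (by simp)),
        hW.integral_eq_zero, zero_mul, sub_zero]
      exact (hW.integral_mul h s).trans s.2
  have hsplit (k : ℕ) :
      expect hW (MvPolynomial.X h ^ k * MvPolynomial.rename Subtype.val r) =
        ((∫ x, x ^ k ∂(gaussianReal 0 1) : ℝ) : 𝕜) *
          expect hW (MvPolynomial.rename Subtype.val r) := by
    have hi : IndepFun (fun ω => ((W h ω : 𝕜)) ^ k)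
        (evalProcess W (MvPolynomial.rename Subtype.val r : MvPolynomial H 𝕜)) P := by
      have := hindep.comp (φ := fun x => ((x () : ℝ) : 𝕜) ^ k)
        (ψ := fun y => MvPolynomial.eval (fun s => (y s : 𝕜)) r) (by fun_prop) (by
          induction r using MvPolynomial.induction_on with
          | C a => simp
          | add p q hp hq => simp only [map_add]; exact hp.add hq
          | mul_X p s hp =>
            simp only [map_mul, MvPolynomial.eval_X]
            exact hp.mul (RCLike.measurable_ofReal.comp (measurable_pi_apply s)))
      have e : evalProcess W (MvPolynomial.rename Subtype.val r : MvPolynomial H 𝕜) =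
          (fun y => MvPolynomial.eval (fun s => (y s : 𝕜)) r) ∘
            fun ω (s : {g : H // inner ℝ h g = 0}) => W s ω := by
        ext ω
        simp [evalProcess, MvPolynomial.eval_rename, Function.comp_def]
      rw [e]
      exact this
    have hlaw : P.map (W h) = gaussianReal 0 1 := by
      rw [(hW.isGaussianProcess.hasGaussianLaw_eval h).map_eq_gaussianReal, hW.integral_eq_zero,
        variance_of_integral_eq_zero (hW.isGaussianProcess.aemeasurable h) (hW.integral_eq_zero h)]
      have := hW.integral_mul h h
      rw [real_inner_self_eq_norm_sq, hh] at this
      simp only [sq, this]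
      simp
    rw [← hlaw, integral_map (hW.isGaussianProcess.aemeasurable h) (by fun_prop), expect_apply,
      expect_apply, ← integral_ofReal]
    simp only [RCLike.ofReal_pow]
    rw [← hi.integral_fun_mul_eq_mul_integral]
    · simp [evalProcess]
    · have := hasAllMoments_evalProcess hW (MvPolynomial.X h ^ k : MvPolynomial H 𝕜) 2 (by simp)
      have e : evalProcess W (MvPolynomial.X h ^ k : MvPolynomial H 𝕜) =
          fun ω => (W h ω : 𝕜) ^ k := by ext; simp [evalProcess]
      exact e ▸ this.aestronglyMeasurable
    · exact (integrable_evalProcess hW _).aestronglyMeasurable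
  rw [hsplit, hsplit, integral_pow_succ_gaussianReal, RCLike.ofReal_mul, RCLike.ofReal_natCast,
    mul_assoc]

/-- Gaussian integration by parts. -/
lemma expect_X_mul {W : H → Ω → ℝ} (hW : IsIsonormal P W) (h : H) (p : MvPolynomial H 𝕜) :
    expect hW (MvPolynomial.X h * p) = expect hW (annihilation 𝕜 h p) := by
  -- The formal variables satisfy no linear relations; linearity in the index holds only after
  -- taking expectations, through almost sure linearity of `W`.
  have lin (a b : ℝ) (f g : H) (q : MvPolynomial H 𝕜) :
      expect hW (q * MvPolynomial.X (a • f + b • g)) =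
        (a : 𝕜) * expect hW (q * MvPolynomial.X f) + (b : 𝕜) * expect hW (q * MvPolynomial.X g) := by
    rw [← smul_eq_mul (a : 𝕜), ← smul_eq_mul (b : 𝕜), ← map_smul, ← map_smul, ← map_add,
      expect_apply, expect_apply]
    refine integral_congr_ae ?_
    filter_upwards [hW.smul_add_smul a b f g] with ω hω
    simp only [evalProcess, map_add, map_mul, MvPolynomial.smul_eval, MvPolynomial.eval_X, hω]
    ring
  rcases eq_or_ne h 0 with rfl | h0
  · have h1 : annihilation 𝕜 (0 : H) p = 0 := by
      simpa using annihilation_smul 𝕜 0 (0 : H) p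
    rw [h1, map_zero, mul_comm]
    simpa using lin 0 0 0 0 p
  have unit (u : H) (hu : ‖u‖ = 1) (p : MvPolynomial H 𝕜) :
      expect hW (MvPolynomial.X u * p) = expect hW (annihilation 𝕜 u p) := by
    -- The claim is strengthened to integration by parts for `X_u^k r p`, with `r` in the variables
    -- orthogonal to `u`, so that an induction on `p` can move its variables into the prefactor. The
    -- claim itself is `k = 0`, `r = 1`.
    suffices hs : ∀ (k : ℕ) (r : MvPolynomial {g : H // inner ℝ u g = 0} 𝕜),
        expect hW (MvPolynomial.X u ^ (k + 1) * MvPolynomial.rename Subtype.val r * p) =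
        (k : 𝕜) * expect hW (MvPolynomial.X u ^ (k - 1) * MvPolynomial.rename Subtype.val r * p) +
        expect hW (MvPolynomial.X u ^ k * MvPolynomial.rename Subtype.val r *
          annihilation 𝕜 u p) by
      simpa using hs 0 1
    induction p using MvPolynomial.induction_on with
    | C a =>
      intro k r
      have e (q : MvPolynomial H 𝕜) : q * MvPolynomial.C a = a • q := by
        rw [MvPolynomial.smul_eq_C_mul, mul_comm]
      simp only [annihilation_C, mul_zero, map_zero, add_zero, e, map_smul,
        expect_pow_succ_mul_rename hW hu, smul_eq_mul]
      ring
    | add p q hp hq =>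
      intro k r
      simp only [map_add, mul_add, hp, hq]
      ring
    | mul_X p f hp =>
      intro k r
      -- Split `f = a u + g` with `g ⊥ u`: the first part raises the exponent `k`, the second is
      -- absorbed into `r`.
      set a : ℝ := inner ℝ u f with ha
      have hf' : inner ℝ u (f - a • u) = 0 := by
        rw [inner_sub_right, inner_smul_right, real_inner_self_eq_norm_sq, hu, ← ha]; ring
      set g : {g : H // inner ℝ u g = 0} := ⟨f - a • u, hf'⟩ with hg
      have hf : f = a • u + (1 : ℝ) • (g : H) := by simp [hg]
      have l (q : MvPolynomial H 𝕜) : expect hW (q * MvPolynomial.X f) =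
          (a : 𝕜) * expect hW (q * MvPolynomial.X u) + expect hW (q * MvPolynomial.X (g : H)) := by
        conv_lhs => rw [hf, lin]
        simp
      have h1 := hp (k + 1) r
      have h2 := hp k (r * MvPolynomial.X g)
      simp only [map_mul, MvPolynomial.rename_X, Nat.cast_add, Nat.cast_one,
        Nat.add_sub_cancel] at h1 h2
      have e3 : MvPolynomial.X u ^ k * MvPolynomial.rename Subtype.val r *
          annihilation 𝕜 u (p * MvPolynomial.X f) =
          (a : 𝕜) • (MvPolynomial.X u ^ k * MvPolynomial.rename Subtype.val r * p) +
          MvPolynomial.X u ^ k * MvPolynomial.rename Subtype.val r * annihilation 𝕜 u p *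
            MvPolynomial.X f := by
        simp only [Derivation.leibniz, annihilation_X, smul_eq_mul, MvPolynomial.smul_eq_C_mul,
          ← ha]
        ring
      rw [← mul_assoc, ← mul_assoc, e3, map_add, map_smul, l, l, l]
      -- `X_u^(k-1) * X_u = X_u^k` fails at `k = 0` under truncated subtraction, but the factor `k`
      -- then vanishes.
      have hk : (k : 𝕜) * expect hW (MvPolynomial.X u ^ (k - 1) *
          MvPolynomial.rename Subtype.val r * p * MvPolynomial.X u) =
          k * expect hW (MvPolynomial.X u ^ k * MvPolynomial.rename Subtype.val r * p) := by
        rcases k with _ | k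
        · simp
        · congr 2
          rw [Nat.add_sub_cancel]
          ring
      have c1 (q r : MvPolynomial H 𝕜) (n : ℕ) : MvPolynomial.X u ^ n * r * q *
          MvPolynomial.X u = MvPolynomial.X u ^ (n + 1) * r * q := by ring
      have c2 (q r x : MvPolynomial H 𝕜) (n : ℕ) : MvPolynomial.X u ^ n * (r * x) * q =
        MvPolynomial.X u ^ n * r * q * x := by ring
      simp only [c2] at h2
      rw [c1 p _ (k + 1), c1 (annihilation 𝕜 u p), h1, h2, smul_eq_mul]
      linear_combination (-(a : 𝕜)) * hk
  set t : ℝ := ‖h‖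
  have ht : h = t • (t⁻¹ • h) := by
    rw [smul_smul, mul_inv_cancel₀ (norm_ne_zero_iff.mpr h0), one_smul]
  have hu : ‖t⁻¹ • h‖ = 1 := by simp [t, norm_smul, h0]
  conv_lhs => rw [ht]
  conv_rhs => rw [ht]
  rw [annihilation_smul, map_smul, ← unit _ hu, mul_comm]
  have := lin t 0 (t⁻¹ • h) 0 p
  simp only [zero_smul, add_zero, RCLike.ofReal_zero, zero_mul] at this
  rw [this, smul_eq_mul, mul_comm p]

end

/-! ### Hilbert tensor powers -/

section Extension

variable {𝕜 E F S : Type*} [RCLike 𝕜] [NormedAddCommGroup E] [InnerProductSpace 𝕜 E]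
  [NormedAddCommGroup F] [InnerProductSpace 𝕜 F] [CompleteSpace F]

/-- A map between families with proportional Gram matrices extends to the closed spans. -/
lemma exists_clm_of_inner_eq (v : S → E) (w : S → F) (c : ℝ)
    (hv : Dense (Submodule.span 𝕜 (Set.range v) : Set E))
    (h : ∀ s t, inner 𝕜 (w s) (w t) = (c : 𝕜) * inner 𝕜 (v s) (v t)) :
    ∃ T : E →L[𝕜] F, (∀ s, T (v s) = w s) ∧
      ∀ x y, inner 𝕜 (T x) (T y) = (c : 𝕜) * inner 𝕜 x y := by
  -- Formal combinations avoid any question of well-definedness when `v` is linearly dependent: the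
  -- Gram identity bounds `f` by `e`, and `f` extends along the dense range of `e`.
  set e := Finsupp.linearCombination 𝕜 v
  set f := Finsupp.linearCombination 𝕜 w
  have hin (a b : S →₀ 𝕜) : inner 𝕜 (f a) (f b) = (c : 𝕜) * inner 𝕜 (e a) (e b) := by
    simp only [e, f, Finsupp.linearCombination_apply, Finsupp.sum, sum_inner, inner_sum,
      inner_smul_left, inner_smul_right, h, Finset.mul_sum]
    refine Finset.sum_congr rfl fun s _ => Finset.sum_congr rfl fun t _ => ?_
    ring
  have hd : DenseRange e := by
    rw [DenseRange, ← LinearMap.coe_range, Finsupp.range_linearCombination]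
    exact hv
  have hb (a : S →₀ 𝕜) : ‖f a‖ ≤ √|c| * ‖e a‖ := by
    have := hin a a
    rw [inner_self_eq_norm_sq_to_K, inner_self_eq_norm_sq_to_K] at this
    have h2 : ‖f a‖ ^ 2 = c * ‖e a‖ ^ 2 := by exact_mod_cast this
    rw [← Real.sqrt_sq (norm_nonneg (e a)), ← Real.sqrt_mul (abs_nonneg c)]
    refine Real.le_sqrt_of_sq_le ?_
    rw [h2]
    gcongr
    exact le_abs_self c
  have hT (a) : f.extendOfNorm e (e a) = f a := LinearMap.extendOfNorm_eq hd ⟨_, hb⟩ a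
  refine ⟨f.extendOfNorm e, fun s => ?_, fun x y => ?_⟩
  · simpa [e, f] using hT (Finsupp.single s 1)
  · refine hd.induction_on₂ (p := fun x y => inner 𝕜 (f.extendOfNorm e x) (f.extendOfNorm e y) =
      (c : 𝕜) * inner 𝕜 x y) (isClosed_eq (by fun_prop) (by fun_prop)) (fun a b => ?_) x y
    rw [hT, hT, hin]

end Extension

section Tensor

variable {𝕜 H ι : Type*} [RCLike 𝕜] [NormedAddCommGroup H] [InnerProductSpace 𝕜 H] [Fintype ι]

lemma inner_tensor_tensor (f g : ι → H) :
    inner 𝕜 (tensor 𝕜 f) (tensor 𝕜 g) = ∏ i, inner 𝕜 (f i) (g i) := by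
  rw [tensor, tensor, UniformSpace.Completion.inner_coe, AlgTensor.inner_tprod_tprod]

lemma dense_span_tensor :
    Dense (Submodule.span 𝕜 (Set.range (tensor 𝕜 : (ι → H) → HilbertTensor 𝕜 H ι)) :
      Set (HilbertTensor 𝕜 H ι)) := by
  refine UniformSpace.Completion.denseRange_coe.mono ?_
  rintro _ ⟨x, rfl⟩
  obtain ⟨n, c, f, rfl⟩ := AlgTensor.exists_sum x
  have : ((∑ a, c a • AlgTensor.tprod (f a) : AlgTensor 𝕜 H ι) : HilbertTensor 𝕜 H ι) =
      ∑ a, c a • tensor 𝕜 (f a) := by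
    have := map_sum (UniformSpace.Completion.toComplL (𝕜 := 𝕜) (E := AlgTensor 𝕜 H ι))
      (fun a => c a • AlgTensor.tprod (f a)) Finset.univ
    exact this.trans (Finset.sum_congr rfl fun a _ => map_smul _ _ _)
  rw [this]
  exact Submodule.sum_mem _ fun a _ => Submodule.smul_mem _ _ (Submodule.subset_span ⟨_, rfl⟩)

lemma eq_zero_of_inner_tensor {u : HilbertTensor 𝕜 H ι}
    (h : ∀ f : ι → H, inner 𝕜 (tensor 𝕜 f) u = 0) : u = 0 := by
  refine dense_span_tensor.eq_zero_of_inner_right (𝕜 := 𝕜) fun v hv => ?_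
  induction hv using Submodule.span_induction with
  | mem x hx => obtain ⟨f, rfl⟩ := hx; exact h f
  | zero => simp
  | add x y _ _ hx hy => rw [inner_add_left, hx, hy, add_zero]
  | smul c x _ hx => rw [inner_smul_left, hx, mul_zero]

/-- `y ↦ f₁ ⊗ ⋯ ⊗ y ⊗ ⋯ ⊗ fₘ` as a continuous linear map. -/
def tensorUpdate [DecidableEq ι] (f : ι → H) (i : ι) : H →L[𝕜] HilbertTensor 𝕜 H ι :=
  LinearMap.mkContinuous
    ((UniformSpace.Completion.toComplL (𝕜 := 𝕜) (E := AlgTensor 𝕜 H ι) :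
      AlgTensor 𝕜 H ι →ₗ[𝕜] HilbertTensor 𝕜 H ι) ∘ₗ
      ((PiTensorProduct.tprod 𝕜).toLinearMap f i : H →ₗ[𝕜] AlgTensor 𝕜 H ι))
    (∏ j ∈ Finset.univ.erase i, ‖f j‖) fun y => by
      change ‖tensor 𝕜 (Function.update f i y)‖ ≤ _
      refine (pow_le_pow_iff_left₀ (norm_nonneg _) (by positivity) two_ne_zero).mp ?_
      refine le_of_eq (RCLike.ofReal_injective (K := 𝕜) ?_)
      push_cast
      rw [← inner_self_eq_norm_sq_to_K, inner_tensor_tensor,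
        ← Finset.mul_prod_erase _ _ (Finset.mem_univ i)]
      simp only [Function.update_self, inner_self_eq_norm_sq_to_K]
      rw [mul_pow, mul_comm, ← Finset.prod_pow]
      congr 1
      exact Finset.prod_congr rfl fun j hj => by
        rw [Function.update_of_ne (Finset.ne_of_mem_erase hj)]

variable {κ : Type*}

lemma orthonormal_tensor (c : HilbertBasis κ 𝕜 H) :
    Orthonormal 𝕜 fun i : ι → κ => tensor 𝕜 (c ∘ i) := by
  classical
  rw [orthonormal_iff_ite]
  intro i j
  rw [inner_tensor_tensor]
  simp only [Function.comp_apply, orthonormal_iff_ite.mp c.orthonormal]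
  rw [Finset.prod_ite_zero]
  simp [funext_iff]

/-- Basis vectors are replaced by arbitrary vectors one slot at a time; `s` is the set of slots
already freed. In each slot the pairing is continuous and conjugate-linear, and it vanishes on a
basis. -/
lemma eq_zero_of_inner_tensor_basis (c : HilbertBasis κ 𝕜 H) {u : HilbertTensor 𝕜 H ι}
    (h : ∀ i : ι → κ, inner 𝕜 (tensor 𝕜 (c ∘ i)) u = 0) : u = 0 := by
  classical
  have key (s : Finset ι) : ∀ f : ι → H, (∀ i ∉ s, f i ∈ Set.range c) →
      inner 𝕜 (tensor 𝕜 f) u = 0 := by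
    induction s using Finset.induction_on with
    | empty =>
      intro f hf
      choose k hk using fun i => hf i (Finset.notMem_empty i)
      obtain rfl : f = c ∘ k := funext fun i => (hk i).symm
      exact h k
    | insert a s ha ih =>
      intro f hf
      let L : H →L⋆[𝕜] 𝕜 := ((innerSL 𝕜).flip u).comp (tensorUpdate (𝕜 := 𝕜) f a)
      have hL (y : H) : L y = inner 𝕜 (tensor 𝕜 (Function.update f a y)) u := rfl
      have h0 : L = 0 := by
        refine ContinuousLinearMap.ext_on
          (Submodule.dense_iff_topologicalClosure_eq_top.mpr c.dense_span) ?_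
        rintro _ ⟨k, rfl⟩
        rw [hL]
        refine ih _ fun i hi => ?_
        rcases eq_or_ne i a with rfl | hia
        · exact ⟨k, by simp⟩
        · rw [Function.update_of_ne hia]
          exact hf i (by simp [hia, hi])
      have := hL (f a)
      rw [Function.update_eq_self, h0] at this
      simpa using this.symm
  exact eq_zero_of_inner_tensor fun f => key Finset.univ f fun i hi => absurd (Finset.mem_univ i) hi

lemma hasSum_tensor (c : HilbertBasis κ 𝕜 H) (u : HilbertTensor 𝕜 H ι) :
    HasSum (fun i : ι → κ => (inner 𝕜 (tensor 𝕜 (c ∘ i)) u : 𝕜) • tensor 𝕜 (c ∘ i)) u := by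
  let b := HilbertBasis.mkOfOrthogonalEqBot (orthonormal_tensor (ι := ι) c) (by
    rw [Submodule.eq_bot_iff]
    intro u hu
    exact eq_zero_of_inner_tensor_basis c fun i => hu _ (Submodule.subset_span ⟨i, rfl⟩))
  have := b.hasSum_repr u
  simpa [b, HilbertBasis.repr_apply_apply] using this

variable {m : ℕ}

lemma symmTensor_mem (f : Fin m → H) : symmTensor 𝕜 f ∈ SymPower 𝕜 H m :=
  Submodule.le_topologicalClosure _ (Submodule.subset_span ⟨f, rfl⟩)

lemma inner_symmTensor_tensor (f g : Fin m → H) :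
    inner 𝕜 (symmTensor 𝕜 f) (tensor 𝕜 g) =
      (m.factorial : 𝕜)⁻¹ * ∑ σ : Equiv.Perm (Fin m), ∏ i, inner 𝕜 (f i) (g (σ i)) := by
  rw [symmTensor, inner_smul_left, sum_inner, map_inv₀, map_natCast]
  congr 1
  rw [← Equiv.sum_comp (Equiv.inv (Equiv.Perm (Fin m)))]
  refine Finset.sum_congr rfl fun σ _ => ?_
  rw [inner_tensor_tensor, ← Equiv.prod_comp σ]
  simp

/-- Symmetrizing the second argument as well changes nothing: the sum over permutations is
translation invariant, so the `m!` terms coincide. -/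
lemma inner_symmTensor_symmTensor (f g : Fin m → H) :
    inner 𝕜 (symmTensor 𝕜 f) (symmTensor 𝕜 g) =
      (m.factorial : 𝕜)⁻¹ * ∑ σ : Equiv.Perm (Fin m), ∏ i, inner 𝕜 (f i) (g (σ i)) := by
  conv_lhs => rw [symmTensor.eq_def 𝕜 g, inner_smul_right, inner_sum]
  have (τ : Equiv.Perm (Fin m)) : inner 𝕜 (symmTensor 𝕜 f) (tensor 𝕜 (g ∘ τ)) =
      (m.factorial : 𝕜)⁻¹ * ∑ σ : Equiv.Perm (Fin m), ∏ i, inner 𝕜 (f i) (g (σ i)) := by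
    rw [inner_symmTensor_tensor,
      ← Equiv.sum_comp (Equiv.mulLeft τ) (fun σ => ∏ i, inner 𝕜 (f i) (g (σ i)))]
    simp
  simp only [this]
  rw [Finset.sum_const, Finset.card_univ, Fintype.card_perm, Fintype.card_fin, nsmul_eq_mul,
    ← mul_assoc, inv_mul_cancel₀, one_mul]
  exact_mod_cast m.factorial_ne_zero

instance : CompleteSpace (SymPower 𝕜 H m) :=
  (Submodule.isClosed_topologicalClosure _).completeSpace_coe

/-- `tensor 𝕜 f` and `symmTensor 𝕜 f` have the same inner product with every symmetrized tensor, so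
their difference is orthogonal to the closed span. -/
lemma orthogonalProjectionOnto_tensor (f : Fin m → H) :
    (SymPower 𝕜 H m).orthogonalProjectionOnto (tensor 𝕜 f) = ⟨symmTensor 𝕜 f, symmTensor_mem f⟩ := by
  refine Subtype.ext ?_
  refine Submodule.eq_starProjection_of_mem_of_inner_eq_zero (symmTensor_mem f) fun w hw => ?_
  have hcl : IsClosed {w : HilbertTensor 𝕜 H (Fin m) |
      inner 𝕜 (tensor 𝕜 f - symmTensor 𝕜 f) w = 0} := isClosed_eq (by fun_prop) (by fun_prop)
  refine closure_minimal (fun w hw => ?_) hcl hw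
  change inner 𝕜 _ w = 0
  induction hw using Submodule.span_induction with
  | mem x hx =>
    obtain ⟨g, rfl⟩ := hx
    rw [← inner_conj_symm, inner_sub_right, inner_symmTensor_tensor, inner_symmTensor_symmTensor,
      sub_self, map_zero]
  | zero => simp
  | add x y _ _ hx hy => rw [inner_add_right, hx, hy, add_zero]
  | smul c x _ hx => rw [inner_smul_right, hx, mul_zero]

/-- Projecting the expansion in the tensor basis keeps all multi-indices, repetitions under
permutation included; this is the form of the sum in `realIntegral`. -/
lemma hasSum_symmTensor (c : HilbertBasis κ 𝕜 H) (u : SymPower 𝕜 H m) :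
    HasSum (fun i : Fin m → κ => (inner 𝕜 (tensor 𝕜 (c ∘ i)) (u : HilbertTensor 𝕜 H (Fin m)) : 𝕜) •
      (⟨symmTensor 𝕜 (c ∘ i), symmTensor_mem _⟩ : SymPower 𝕜 H m)) u := by
  have := (hasSum_tensor c (u : HilbertTensor 𝕜 H (Fin m))).mapL
    (SymPower 𝕜 H m).orthogonalProjectionOnto
  simpa [orthogonalProjectionOnto_tensor] using this

lemma dense_span_symmTensor :
    Dense (Submodule.span 𝕜 (Set.range fun f : Fin m → H =>
      (⟨symmTensor 𝕜 f, symmTensor_mem f⟩ : SymPower 𝕜 H m)) : Set (SymPower 𝕜 H m)) := by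
  rw [Subtype.dense_iff]
  refine fun x hx => closure_mono ?_ hx
  have : (Submodule.span 𝕜 (Set.range fun f : Fin m → H =>
      (⟨symmTensor 𝕜 f, symmTensor_mem f⟩ : SymPower 𝕜 H m))).map (SymPower 𝕜 H m).subtype =
      Submodule.span 𝕜 (Set.range fun f : Fin m → H => symmTensor 𝕜 f) := by
    rw [Submodule.map_span, ← Set.range_comp]
    rfl
  rw [← this]
  rintro _ ⟨y, hy, rfl⟩
  exact ⟨y, hy, rfl⟩

end Tensor

/-! ### Creation operators acting on finite products -/

section Wick

variable {R A V κ : Type*} [CommRing R] [CommRing A] [Algebra R A]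

lemma deriv_prod_eq_zero (D : Derivation R A A) (s : Finset κ) (F : κ → A)
    (h : ∀ k ∈ s, D (F k) = 0) : D (∏ k ∈ s, F k) = 0 := by
  refine Finset.prod_induction F (fun a => D a = 0) (fun a b ha hb => ?_) (by simp) h
  rw [Derivation.leibniz, ha, hb, smul_zero, smul_zero, add_zero]

/-- A creation operator acts on a product through the only factor that its derivation does not
annihilate. -/
lemma raise_prod (x : V → A) (D : V → Derivation R A A) (v : V) {s : Finset κ} (F G : κ → A)
    {k₀ : κ} (hk₀ : k₀ ∈ s) (hD : ∀ k ∈ s, k ≠ k₀ → D v (F k) = 0)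
    (h₀ : G k₀ = raise x D v (F k₀)) (hne : ∀ k, k ≠ k₀ → G k = F k) :
    raise x D v (∏ k ∈ s, F k) = ∏ k ∈ s, G k := by
  classical
  rw [← Finset.mul_prod_erase _ _ hk₀, ← Finset.mul_prod_erase _ G hk₀, h₀,
    Finset.prod_congr rfl fun k hk => hne k (Finset.ne_of_mem_erase hk), raise_apply, raise_apply,
    Derivation.leibniz, deriv_prod_eq_zero (D v) _ F fun k hk =>
      hD k (Finset.mem_of_mem_erase hk) (Finset.ne_of_mem_erase hk)]
  simp only [smul_eq_mul]
  ring

end Wick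

lemma indexCount_succ {κ : Type*} {m : ℕ} (i : Fin (m + 1) → κ) (k : κ) [Decidable (k = i 0)] :
    indexCount i k = indexCount (fun a => i a.succ) k + if k = i 0 then 1 else 0 := by
  classical
  simp only [indexCount, Finset.card_filter, Fin.sum_univ_succ, eq_comm (a := k)]
  rw [add_comm]

/-! ### The real multiple integral as an extension of Wick products -/

section RealIntegral

variable {Ω : Type*} [MeasurableSpace Ω] {P : Measure Ω}
variable {H : Type*} [NormedAddCommGroup H] [InnerProductSpace ℝ H]
variable (𝕜 : Type*) [RCLike 𝕜]

/-- The Wick product `:X_{f₁} ⋯ X_{fₘ}:` as a polynomial. -/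
def wickPoly {m : ℕ} (f : Fin m → H) : MvPolynomial H 𝕜 :=
  wick MvPolynomial.X (annihilation 𝕜) f

variable {𝕜}

lemma memLp_evalProcess {W : H → Ω → ℝ} (hW : IsIsonormal P W) (p : MvPolynomial H 𝕜) :
    MemLp (evalProcess W p) 2 P :=
  hasAllMoments_evalProcess hW p 2 (by simp)

/-- The element of `L²` given by a polynomial in the variables `W(h)`. -/
def toL2 {W : H → Ω → ℝ} (hW : IsIsonormal P W) : MvPolynomial H 𝕜 →ₗ[𝕜] Lp 𝕜 2 P where
  toFun p := (memLp_evalProcess hW p).toLp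
  map_add' p q := by
    rw [← MemLp.toLp_add]
    congr 1
    ext ω; simp [evalProcess]
  map_smul' c p := by
    rw [RingHom.id_apply, ← MemLp.toLp_const_smul]
    congr 1
    ext ω; simp [evalProcess, MvPolynomial.smul_eq_C_mul]

lemma coeFn_toL2 {W : H → Ω → ℝ} (hW : IsIsonormal P W) (p : MvPolynomial H 𝕜) :
    toL2 hW p =ᵐ[P] evalProcess W p :=
  MemLp.coeFn_toLp (memLp_evalProcess hW p)

lemma inner_toL2_wickPoly {W : H → Ω → ℝ} (hW : IsIsonormal P W) {m : ℕ} (f g : Fin m → H) :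
    inner ℝ (toL2 hW (wickPoly ℝ f)) (toL2 hW (wickPoly ℝ g)) =
      ∑ σ : Equiv.Perm (Fin m), ∏ i, inner ℝ (f i) (g (σ i)) := by
  have key := expect_wick_mul_wick (B := fun g h : H => inner ℝ g h)
    (x := (MvPolynomial.X : H → MvPolynomial H ℝ)) (D := annihilation ℝ)
    (fun v w => annihilation_X ℝ v w) (annihilation_comm ℝ) (expect hW) (expect_one hW)
    (expect_X_mul hW) f g
  rw [← key, L2.inner_def, expect_apply]
  refine integral_congr_ae ?_
  filter_upwards [coeFn_toL2 hW (wickPoly ℝ f), coeFn_toL2 hW (wickPoly ℝ g)] with ω h₁ h₂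
  rw [h₁, h₂]
  simp [evalProcess, wickPoly, mul_comm]

/-- The permanent is `m!` times the Gram matrix of the symmetrized tensors, whose normalization
carries one factor `1/m!`. -/
lemma exists_integral {W : H → Ω → ℝ} (hW : IsIsonormal P W) (m : ℕ) :
    ∃ T : SymPower ℝ H m →L[ℝ] Lp ℝ 2 P,
      (∀ f, T ⟨symmTensor ℝ f, symmTensor_mem f⟩ = toL2 hW (wickPoly ℝ f)) ∧
      ∀ u v, inner ℝ (T u) (T v) = m.factorial * inner ℝ u v := by
  have h (f g : Fin m → H) : inner ℝ (toL2 hW (wickPoly ℝ f)) (toL2 hW (wickPoly ℝ g)) =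
      (m.factorial : ℝ) * inner ℝ (⟨symmTensor ℝ f, symmTensor_mem f⟩ : SymPower ℝ H m)
        ⟨symmTensor ℝ g, symmTensor_mem g⟩ := by
    have h₀ : (m.factorial : ℝ) ≠ 0 := by exact_mod_cast m.factorial_ne_zero
    rw [inner_toL2_wickPoly, Submodule.coe_inner, inner_symmTensor_symmTensor, ← mul_assoc,
      mul_inv_cancel₀ h₀, one_mul]
  obtain ⟨T, hT, hT'⟩ := exists_clm_of_inner_eq (𝕜 := ℝ) _ _ (m.factorial : ℝ)
    dense_span_symmTensor h
  exact ⟨T, hT, hT'⟩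

lemma annihilation_aeval (g h : H) (p : Polynomial ℤ) :
    annihilation 𝕜 g (Polynomial.aeval (MvPolynomial.X h) p) =
      Polynomial.aeval (MvPolynomial.X h) (Polynomial.derivative p) *
        MvPolynomial.C ((inner ℝ g h : ℝ) : 𝕜) := by
  rw [← Polynomial.aeval_map_algebraMap 𝕜, Derivation.map_aeval, Polynomial.derivative_map,
    Polynomial.aeval_map_algebraMap, annihilation_X, smul_eq_mul]

/-- By orthonormality, creation at `c (i 0)` acts only on the factor of index `i 0`, where it is the
Hermite recursion `He_{n+1} = x He_n - He_n'`. Indices of `s` not hit by `i` contribute `He_0 = 1`;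
allowing them keeps `s` fixed during the induction. -/
lemma wickPoly_orthonormal {κ : Type*} {c : κ → H} (hc : Orthonormal ℝ c) {m : ℕ}
    (i : Fin m → κ) (s : Finset κ) (hs : ∀ a, i a ∈ s) :
    wickPoly 𝕜 (c ∘ i) = ∏ k ∈ s,
      Polynomial.aeval (MvPolynomial.X (c k)) (Polynomial.hermite (indexCount i k)) := by
  classical
  have hinner := orthonormal_iff_ite.mp hc
  induction m with
  | zero => simp [wickPoly, wick_zero, indexCount]
  | succ m ih =>
    rw [wickPoly, wick_succ]
    change raise _ _ _ (wickPoly 𝕜 (c ∘ fun a => i a.succ)) = _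
    rw [ih (fun a => i a.succ) fun a => hs _]
    refine raise_prod _ _ _ _ _ (hs 0) (fun k _ hk => ?_) ?_ fun k hk => ?_
    · rw [annihilation_aeval, Function.comp_apply, hinner, if_neg hk.symm]
      simp
    · rw [indexCount_succ, if_pos rfl, Polynomial.hermite_succ, raise_apply, annihilation_aeval,
        Function.comp_apply, hinner, if_pos rfl]
      simp
    · rw [indexCount_succ, if_neg hk, add_zero]

omit [MeasurableSpace Ω] in
lemma fourierHermite_eq {κ : Type*} (W : H → Ω → ℝ) {c : κ → H} (hc : Orthonormal ℝ c) {m : ℕ}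
    (i : Fin m → κ) : fourierHermite W c i = evalProcess W (wickPoly ℝ (c ∘ i)) := by
  classical
  ext ω
  rw [wickPoly_orthonormal hc i (Finset.univ.image i) (by simp), fourierHermite, evalProcess,
    map_prod]
  refine Finset.prod_congr (by congr) fun k _ => ?_
  have := Polynomial.hom_eval₂ (Polynomial.hermite (indexCount i k)) (algebraMap ℤ _)
    (MvPolynomial.eval fun h => (W h ω : ℝ)) (MvPolynomial.X (c k))
  rw [Polynomial.aeval_def, Polynomial.aeval_def]
  refine Eq.trans ?_ this.symm
  simp only [MvPolynomial.eval_X]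
  congr 1
  exact RingHom.ext_int _ _

/-- `T` does not involve a basis, so this also gives the independence of the integral from `c`. -/
lemma realIntegral_eq {κ : Type*} {W : H → Ω → ℝ} (hW : IsIsonormal P W) {m : ℕ}
    {T : SymPower ℝ H m →L[ℝ] Lp ℝ 2 P}
    (hT : ∀ f, T ⟨symmTensor ℝ f, symmTensor_mem f⟩ = toL2 hW (wickPoly ℝ f))
    (c : HilbertBasis κ ℝ H) (u : SymPower ℝ H m) : realIntegral hW c m u = T u := by
  rw [← ((hasSum_symmTensor c u).mapL T).tsum_eq, realIntegral]
  refine tsum_congr fun i => ?_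
  rw [map_smul, hT]
  congr 1
  exact MemLp.toLp_congr _ (memLp_evalProcess hW _) (by rw [fourierHermite_eq W c.orthonormal i])

end RealIntegral

/-! ### Complex Hermite polynomials as polynomials in two variables -/

/-- `p ↦ z p - ∂p/∂z̄`. -/
def hermiteRaise (p : MvPolynomial (Fin 2) ℂ) : MvPolynomial (Fin 2) ℂ :=
  MvPolynomial.X 0 * p - MvPolynomial.pderiv 1 p

/-- `p ↦ z̄ p - ∂p/∂z`. -/
def hermiteRaiseBar (p : MvPolynomial (Fin 2) ℂ) : MvPolynomial (Fin 2) ℂ :=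
  MvPolynomial.X 1 * p - MvPolynomial.pderiv 0 p

/-- `hermitePoly` applies the barred operators first; commutation allows either index to be raised
last, as the recursion over words requires. -/
lemma hermiteRaise_comm (p : MvPolynomial (Fin 2) ℂ) :
    hermiteRaiseBar (hermiteRaise p) = hermiteRaise (hermiteRaiseBar p) := by
  have h : MvPolynomial.pderiv (R := ℂ) (0 : Fin 2) (MvPolynomial.pderiv 1 p) =
      MvPolynomial.pderiv 1 (MvPolynomial.pderiv 0 p) := by
    have : ⁅(MvPolynomial.pderiv (0 : Fin 2) : Derivation ℂ (MvPolynomial (Fin 2) ℂ)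
        (MvPolynomial (Fin 2) ℂ)), MvPolynomial.pderiv (R := ℂ) (1 : Fin 2)⁆ = 0 := by
      refine MvPolynomial.derivation_ext fun k => ?_
      rw [Derivation.commutator_apply]
      fin_cases k <;> simp [MvPolynomial.pderiv_X]
    have := DFunLike.congr_fun this p
    rwa [Derivation.commutator_apply, Derivation.zero_apply, sub_eq_zero] at this
  simp only [hermiteRaise, hermiteRaiseBar, map_sub, Derivation.leibniz, h,
    MvPolynomial.pderiv_X_self, smul_eq_mul]
  ring

/-- The polynomial `p` with `J_{m,n}(z, 1) = p(z, z̄)`. -/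
def hermitePoly (m n : ℕ) : MvPolynomial (Fin 2) ℂ := hermiteRaise^[m] (hermiteRaiseBar^[n] 1)

lemma hermitePoly_succ_left (m n : ℕ) : hermitePoly (m + 1) n = hermiteRaise (hermitePoly m n) :=
  Function.iterate_succ_apply' _ _ _

lemma hermitePoly_succ_right (m n : ℕ) :
    hermitePoly m (n + 1) = hermiteRaiseBar (hermitePoly m n) := by
  have h : Function.Commute hermiteRaiseBar hermiteRaise := hermiteRaise_comm
  rw [hermitePoly, Function.iterate_succ_apply', ← (h.iterate_right m).eq]
  rfl

/-- The substitution `(z, z̄) ↦ (√2 z, √2 z̄)`. -/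
def dilate : MvPolynomial (Fin 2) ℂ →ₐ[ℂ] MvPolynomial (Fin 2) ℂ :=
  MvPolynomial.aeval fun j => MvPolynomial.C ((√2 : ℝ) : ℂ) * MvPolynomial.X j

lemma evalConj_dilate (p : MvPolynomial (Fin 2) ℂ) (z : ℂ) :
    evalConj (dilate p) z = evalConj p (√2 * z) := by
  induction p using MvPolynomial.induction_on with
  | C a => simp [evalConj, dilate]
  | add p q hp hq => simp only [evalConj, map_add] at *; rw [hp, hq]
  | mul_X p i hp =>
    simp only [evalConj, map_mul] at *
    rw [hp]
    fin_cases i <;> simp [dilate]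

lemma pderiv_dilate (j : Fin 2) (p : MvPolynomial (Fin 2) ℂ) :
    MvPolynomial.pderiv j (dilate p) =
      MvPolynomial.C ((√2 : ℝ) : ℂ) * dilate (MvPolynomial.pderiv j p) := by
  induction p using MvPolynomial.induction_on with
  | C a => simp [dilate]
  | add p q hp hq => simp only [map_add, hp, hq, mul_add]
  | mul_X p i hp =>
    have h : dilate (MvPolynomial.X i) = MvPolynomial.C ((√2 : ℝ) : ℂ) * MvPolynomial.X i := by
      simp [dilate]
    simp only [map_mul, map_add, Derivation.leibniz, smul_eq_mul, hp, h, MvPolynomial.pderiv_C,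
      MvPolynomial.pderiv_X, mul_zero, add_zero]
    by_cases hij : i = j
    · subst hij; simp; ring
    · simp [Ne.symm hij]; ring

/-- Dilation by `√2` turns `-∂ + z/2` into the `ρ = 1` operator at the cost of one factor `√2` per
application. The scalar prefactor supplies exactly these, as `2^(m+n) / √2^(m+n) = √2^(m+n)`. -/
lemma complexHermite_two (m n : ℕ) (z : ℂ) :
    ((√2 : ℂ) ^ (m + n))⁻¹ * complexHermite m n 2 (√2 * z) = evalConj (hermitePoly m n) z := by
  set r : ℂ := ((√2 : ℝ) : ℂ) with hr
  have hr2 : r * r = 2 := by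
    rw [hr, ← Complex.ofReal_mul, Real.mul_self_sqrt zero_le_two]; norm_num
  have hr0 : r ≠ 0 := by rintro h; simp [h] at hr2
  have hinv : (2 : ℂ)⁻¹ * r = r⁻¹ := by rw [← hr2]; field_simp
  -- The induction carries the polynomial of the iterate together with its dilated form, one factor
  -- `r = √2` per operator.
  have h₁ : ∃ p, (creationBar 2)^[n] (fun _ => 1) = evalConj p ∧
      MvPolynomial.C (r ^ n) * dilate p = hermiteRaiseBar^[n] 1 := by
    induction n with
    | zero => exact ⟨1, by ext; simp [evalConj], by simp⟩
    | succ n ih =>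
      obtain ⟨p, hp, hd⟩ := ih
      refine ⟨_, by rw [Function.iterate_succ_apply', hp, creationBar_evalConj], ?_⟩
      rw [Function.iterate_succ_apply', ← hd, hermiteRaiseBar, Derivation.leibniz, pderiv_dilate]
      have hX : dilate (MvPolynomial.X 1) = MvPolynomial.C r * MvPolynomial.X 1 := by
        simp [dilate, hr]
      have hC (a : ℂ) : dilate (MvPolynomial.C a) = MvPolynomial.C a := by simp [dilate]
      have hone : (MvPolynomial.C r * (MvPolynomial.C (((2 : ℝ) : ℂ)⁻¹) * MvPolynomial.C r) :
          MvPolynomial (Fin 2) ℂ) = 1 := by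
        rw [← map_mul, ← map_mul, Complex.ofReal_ofNat, hinv, mul_inv_cancel₀ hr0, map_one]
      simp only [map_add, map_neg, map_mul, hX, hC, pow_succ, MvPolynomial.pderiv_C, smul_eq_mul,
        mul_zero, add_zero]
      linear_combination (MvPolynomial.C (r ^ n) * MvPolynomial.X 1 * dilate p) * hone
  have h₂ : ∃ p, (creation 2)^[m] ((creationBar 2)^[n] fun _ => 1) = evalConj p ∧
      MvPolynomial.C (r ^ (m + n)) * dilate p = hermitePoly m n := by
    induction m with
    | zero => simpa [hermitePoly] using h₁
    | succ m ih =>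
      obtain ⟨p, hp, hd⟩ := ih
      refine ⟨_, by rw [Function.iterate_succ_apply', hp, creation_evalConj], ?_⟩
      rw [hermitePoly_succ_left, ← hd, hermiteRaise, Derivation.leibniz, pderiv_dilate]
      have hX : dilate (MvPolynomial.X 0) = MvPolynomial.C r * MvPolynomial.X 0 := by
        simp [dilate, hr]
      have hC (a : ℂ) : dilate (MvPolynomial.C a) = MvPolynomial.C a := by simp [dilate]
      have hone : (MvPolynomial.C r * (MvPolynomial.C (((2 : ℝ) : ℂ)⁻¹) * MvPolynomial.C r) :
          MvPolynomial (Fin 2) ℂ) = 1 := by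
        rw [← map_mul, ← map_mul, Complex.ofReal_ofNat, hinv, mul_inv_cancel₀ hr0, map_one]
      simp only [map_add, map_neg, map_mul, hX, hC, add_right_comm m 1 n, pow_succ r (m + n),
        MvPolynomial.pderiv_C, smul_eq_mul, mul_zero, add_zero]
      linear_combination (MvPolynomial.C (r ^ (m + n)) * MvPolynomial.X 0 * dilate p) * hone
  obtain ⟨p, hp, hd⟩ := h₂
  rw [complexHermite, hp, ← hd, ← evalConj_dilate]
  simp only [evalConj, map_mul, MvPolynomial.eval_C, Complex.ofReal_ofNat]
  rw [← hr2, mul_pow]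
  field_simp

lemma deriv_aeval_fin_two {A : Type*} [CommRing A] [Algebra ℂ A] (D : Derivation ℂ A A) (a b : A)
    (p : MvPolynomial (Fin 2) ℂ) :
    D (MvPolynomial.aeval ![a, b] p) =
      MvPolynomial.aeval ![a, b] (MvPolynomial.pderiv 0 p) * D a +
        MvPolynomial.aeval ![a, b] (MvPolynomial.pderiv 1 p) * D b := by
  induction p using MvPolynomial.induction_on with
  | C c => simp
  | add p q hp hq => simp only [map_add, hp, hq]; ring
  | mul_X p i hp =>
    fin_cases i <;> simp [hp, MvPolynomial.pderiv_X] <;> ring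

/-! ### Wick products of complex linear combinations -/

section Complex

variable {K : Type*} [NormedAddCommGroup K] [InnerProductSpace ℝ K]

/-- The variable of `a + i b`. -/
def cvar (v : K × K) : MvPolynomial K ℂ :=
  MvPolynomial.X v.1 + MvPolynomial.C Complex.I * MvPolynomial.X v.2

/-- The annihilation operator of `a + i b`. -/
def cann (v : K × K) : Derivation ℂ (MvPolynomial K ℂ) (MvPolynomial K ℂ) :=
  annihilation ℂ v.1 + Complex.I • annihilation ℂ v.2

/-- The bilinear extension of the real inner product. -/
def cform (v w : K × K) : ℂ :=
  ⟨inner ℝ v.1 w.1 - inner ℝ v.2 w.2, inner ℝ v.1 w.2 + inner ℝ v.2 w.1⟩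

lemma cann_cvar (v w : K × K) :
    cann v (cvar w) = algebraMap ℂ (MvPolynomial K ℂ) (cform v w) := by
  have h : cform v w = ((inner ℝ v.1 w.1 : ℝ) : ℂ) + Complex.I * (inner ℝ v.1 w.2 : ℝ) +
      Complex.I * ((inner ℝ v.2 w.1 : ℝ) + Complex.I * (inner ℝ v.2 w.2 : ℝ)) := by
    apply Complex.ext <;> simp [cform]; ring
  rw [h]
  simp only [cann, cvar, Derivation.add_apply, Derivation.smul_apply, map_add,
    Derivation.leibniz, annihilation_X, annihilation_C, smul_zero, add_zero,
    MvPolynomial.smul_eq_C_mul, smul_eq_mul, MvPolynomial.algebraMap_eq, map_mul]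
  simp only [Complex.coe_algebraMap]
  ring

lemma cann_comm (v w : K × K) (p : MvPolynomial K ℂ) :
    cann v (cann w p) = cann w (cann v p) := by
  simp only [cann, Derivation.add_apply, Derivation.smul_apply, map_add, Derivation.map_smul,
    annihilation_comm ℂ v.1, annihilation_comm ℂ v.2]
  simp only [smul_add]
  abel

/-- Creation for `a + i b` is creation for `a` plus `i` times creation for `b`, so a complex Wick
product expands multilinearly into real-vector ones of the same degree. -/
lemma wick_cvar_mem_span {m : ℕ} (v : Fin m → K × K) :
    wick cvar cann v ∈ Submodule.span ℂ (Set.range fun f : Fin m → K => wickPoly ℂ f) := by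
  induction m with
  | zero => exact Submodule.subset_span ⟨Fin.elim0, rfl⟩
  | succ m ih =>
    have key (k : K) (p : MvPolynomial K ℂ)
        (hp : p ∈ Submodule.span ℂ (Set.range fun f : Fin m → K => wickPoly ℂ f)) :
        raise MvPolynomial.X (annihilation ℂ) k p ∈
          Submodule.span ℂ (Set.range fun f : Fin (m + 1) → K => wickPoly ℂ f) := by
      induction hp using Submodule.span_induction with
      | mem x hx =>
        obtain ⟨f, rfl⟩ := hx
        exact Submodule.subset_span ⟨Fin.cons k f, rfl⟩
      | zero => simp
      | add x y _ _ hx hy => rw [map_add]; exact add_mem hx hy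
      | smul c x _ hx => rw [map_smul]; exact Submodule.smul_mem _ _ hx
    have h := ih fun i => v i.succ
    have e : wick cvar cann v =
        raise MvPolynomial.X (annihilation ℂ) (v 0).1 (wick cvar cann fun i => v i.succ) +
        Complex.I • raise MvPolynomial.X (annihilation ℂ) (v 0).2
          (wick cvar cann fun i => v i.succ) := by
      rw [wick_succ]
      simp only [raise_apply, cvar, cann, Derivation.add_apply, Derivation.smul_apply,
        MvPolynomial.smul_eq_C_mul]
      ring
    rw [e]
    exact add_mem (key _ _ h) (Submodule.smul_mem _ _ (key _ _ h))

/-- Wick polynomials of real vectors have real coefficients, so they evaluate to real random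
variables. -/
lemma map_wickPoly {m : ℕ} (f : Fin m → K) :
    MvPolynomial.map (algebraMap ℝ ℂ) (wickPoly ℝ f) = wickPoly ℂ f := by
  have hD (h : K) (p : MvPolynomial K ℝ) :
      MvPolynomial.map (algebraMap ℝ ℂ) (annihilation ℝ h p) =
        annihilation ℂ h (MvPolynomial.map (algebraMap ℝ ℂ) p) := by
    induction p using MvPolynomial.induction_on with
    | C a => simp
    | add p q hp hq => simp only [map_add, hp, hq]
    | mul_X p k hp => simp [hp]
  induction m with
  | zero => simp [wickPoly, wick_zero]
  | succ m ih =>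
    have := ih fun i => f i.succ
    simp only [wickPoly] at this
    rw [wickPoly, wick_succ, raise_apply, map_sub, map_mul, hD, this, MvPolynomial.map_X]
    rfl

variable {Ω : Type*} [MeasurableSpace Ω] {P : Measure Ω}

lemma expect_cvar_mul {W : K → Ω → ℝ} (hW : IsIsonormal P W) (v : K × K) (p : MvPolynomial K ℂ) :
    expect hW (cvar v * p) = expect hW (cann v p) := by
  rw [cvar, cann, add_mul, mul_assoc, ← MvPolynomial.smul_eq_C_mul, map_add, map_smul,
    expect_X_mul, expect_X_mul]
  simp

omit [MeasurableSpace Ω] in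
lemma evalProcess_wickPoly (W : K → Ω → ℝ) {m : ℕ} (f : Fin m → K) (ω : Ω) :
    evalProcess W (wickPoly ℂ f) ω = (evalProcess W (wickPoly ℝ f) ω : ℝ) := by
  rw [← map_wickPoly, evalProcess, evalProcess, MvPolynomial.eval_map]
  exact (MvPolynomial.eval₂_comp_left (algebraMap ℝ ℂ) (RingHom.id ℝ) (fun h => W h ω) _).symm

end Complex

/-! ### The letters `Z(e_k)` and their conjugates, and the Wick products of words -/

section Letters

variable {H : Type*} [NormedAddCommGroup H] [InnerProductSpace ℝ H]

/-- The vector `a + i b` of `(H ⊕ H)_ℂ` with `Z(h) = W(a) + i W(b)`. -/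
def zvec (h : Complexification H) : WithLp 2 (H × H) × WithLp 2 (H × H) :=
  ((√2)⁻¹ • WithLp.toLp 2 (h.re, -h.im), (√2)⁻¹ • WithLp.toLp 2 (h.im, h.re))

/-- The vector of `(H ⊕ H)_ℂ` that represents the complex conjugate of `Z(h)`. -/
def zbarvec (h : Complexification H) : WithLp 2 (H × H) × WithLp 2 (H × H) :=
  ((zvec h).1, (-1 : ℝ) • (zvec h).2)

lemma sqrt_two_inv_mul_self : (√2)⁻¹ * (√2)⁻¹ = (1 / 2 : ℝ) := by
  rw [← mul_inv, Real.mul_self_sqrt zero_le_two, one_div]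

/-- Circular symmetry, `E[Z(h) Z(k)] = 0`: the vectors `a`, `b` of `h` and `a'`, `b'` of `k` satisfy
`⟪a, a'⟫ = ⟪b, b'⟫` and `⟪a, b'⟫ = -⟪b, a'⟫`. -/
lemma cform_zvec_zvec (h k : Complexification H) : cform (zvec h) (zvec k) = 0 := by
  apply Complex.ext <;>
    simp [cform, zvec, inner_smul_left, inner_smul_right] <;> ring

lemma cform_zbarvec_zbarvec (h k : Complexification H) : cform (zbarvec h) (zbarvec k) = 0 := by
  have := cform_zvec_zvec h k
  rw [Complex.ext_iff] at this ⊢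
  simp only [cform, zbarvec, inner_smul_left, inner_smul_right, conj_trivial, Complex.zero_re,
    Complex.zero_im] at this ⊢
  exact ⟨by linear_combination this.1, by linear_combination -this.2⟩

/-- The order of `k` and `h` is reversed on the right because the inner product is conjugate-linear
in its first argument, while the form is complex linear in the letter `Z(h)`. -/
lemma cform_zvec_zbarvec (h k : Complexification H) :
    cform (zvec h) (zbarvec k) = inner ℂ k h := by
  have e : inner ℂ k h = (⟨inner ℝ k.re h.re + inner ℝ k.im h.im,
    inner ℝ k.re h.im - inner ℝ k.im h.re⟩ : ℂ) := rfl
  rw [e, real_inner_comm h.re k.re, real_inner_comm h.im k.im, real_inner_comm h.im k.re,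
    real_inner_comm h.re k.im]
  apply Complex.ext <;> simp [cform, zvec, zbarvec, inner_smul_left, inner_smul_right]
  · linear_combination (2 * (inner ℝ h.re k.re + inner ℝ h.im k.im)) * sqrt_two_inv_mul_self
  · linear_combination (2 * (inner ℝ h.im k.re - inner ℝ h.re k.im)) * sqrt_two_inv_mul_self

lemma cform_comm {K : Type*} [NormedAddCommGroup K] [InnerProductSpace ℝ K] (v w : K × K) :
    cform v w = cform w v := by
  simp only [cform, real_inner_comm w.1, real_inner_comm w.2]
  rw [add_comm]

variable {κ : Type*}

/-- The vector of the letter `Z(eₖ)` or of its complex conjugate. -/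
def letterVec (e : κ → Complexification H) : κ ⊕ κ → WithLp 2 (H × H) × WithLp 2 (H × H) :=
  Sum.elim (fun k => zvec (e k)) (fun k => zbarvec (e k))

lemma cform_letterVec_eq_zero (e : κ → Complexification H) {a b : κ ⊕ κ}
    (hab : a.isLeft = b.isLeft) : cform (letterVec e a) (letterVec e b) = 0 := by
  rcases a with a | a <;> rcases b with b | b
  · exact cform_zvec_zvec _ _
  · simp at hab
  · simp at hab
  · exact cform_zbarvec_zbarvec _ _

/-- The word `Z(e_{i₁}) ⋯ Z(e_{iₘ}) Z̄(e_{j₁}) ⋯ Z̄(e_{jₙ})`. -/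
def word {m n : ℕ} (i : Fin m → κ) (j : Fin n → κ) : Fin (m + n) → κ ⊕ κ :=
  Sum.map i j ∘ finSumFinEquiv.symm

lemma word_apply {m n : ℕ} (i : Fin m → κ) (j : Fin n → κ) (x : Fin m ⊕ Fin n) :
    word i j (finSumFinEquiv x) = Sum.map i j x := by
  simp [word]

lemma indexCount_word_inl {m n : ℕ} (i : Fin m → κ) (j : Fin n → κ) (k : κ) :
    indexCount (word i j) (Sum.inl k) = indexCount i k := by
  classical
  simp only [indexCount, Finset.card_filter]
  rw [← Equiv.sum_comp finSumFinEquiv, Fintype.sum_sum_type]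
  simp only [word_apply]
  simp

lemma indexCount_word_inr {m n : ℕ} (i : Fin m → κ) (j : Fin n → κ) (k : κ) :
    indexCount (word i j) (Sum.inr k) = indexCount j k := by
  classical
  simp only [indexCount, Finset.card_filter]
  rw [← Equiv.sum_comp finSumFinEquiv, Fintype.sum_sum_type]
  simp only [word_apply]
  simp

/-- Letters of the same kind have zero form. In a nonzero term `σ` would carry the `m` plain
positions of the first word bijectively onto the `n` conjugate positions of the second. -/
lemma sum_perm_cform_eq_zero (e : κ → Complexification H) {m n : ℕ} (hmn : m ≠ n)
    (i i' : Fin m → κ) (j j' : Fin n → κ) :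
    ∑ σ : Equiv.Perm (Fin (m + n)), ∏ a,
      cform (letterVec e (word i j a)) (letterVec e (word i' j' (σ a))) = 0 := by
  refine Finset.sum_eq_zero fun σ _ => ?_
  by_contra h
  rw [Finset.prod_eq_zero_iff] at h
  push Not at h
  have hne (a) : (word i j a).isLeft ≠ (word i' j' (σ a)).isLeft := fun ha =>
    h a (Finset.mem_univ a) (cform_letterVec_eq_zero e ha)
  refine hmn ?_
  have h₁ : ∑ a, (if (word i j a).isLeft then 1 else 0) = m := by
    rw [← Equiv.sum_comp finSumFinEquiv, Fintype.sum_sum_type]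
    simp only [word_apply]
    simp
  have h₂ : ∑ a, (if (word i' j' a).isLeft then 0 else 1) = n := by
    rw [← Equiv.sum_comp finSumFinEquiv, Fintype.sum_sum_type]
    simp only [word_apply]
    simp
  rw [← h₁]
  conv_rhs => rw [← h₂]
  rw [← Equiv.sum_comp σ fun a => if (word i' j' a).isLeft then 0 else 1]
  refine Finset.sum_congr rfl fun a _ => ?_
  have := hne a
  rcases h : (word i j a).isLeft <;> rcases h' : (word i' j' (σ a)).isLeft <;> simp_all

/-- The complex analogue of `wickPoly_orthonormal`: the only nonzero contraction of `Z(e_k)` is with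
its own conjugate, so creation by a letter acts on the factor `k` alone, as `z - ∂/∂z̄` or `z̄ -
∂/∂z`. -/
lemma wick_letterVec {e : κ → Complexification H} (he : Orthonormal ℂ e) {N : ℕ}
    (w : Fin N → κ ⊕ κ) (s : Finset κ) (hs : ∀ a, Sum.elim id id (w a) ∈ s) :
    wick cvar cann (letterVec e ∘ w) = ∏ k ∈ s,
      MvPolynomial.aeval ![cvar (zvec (e k)), cvar (zbarvec (e k))]
        (hermitePoly (indexCount w (Sum.inl k)) (indexCount w (Sum.inr k))) := by
  classical
  have hinner := orthonormal_iff_ite.mp he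
  have hz (k l : κ) (p : MvPolynomial (Fin 2) ℂ) : cann (zvec (e k)) (MvPolynomial.aeval
      ![cvar (zvec (e l)), cvar (zbarvec (e l))] p) =
      if l = k then MvPolynomial.aeval ![cvar (zvec (e l)), cvar (zbarvec (e l))]
        (MvPolynomial.pderiv 1 p) else 0 := by
    rw [deriv_aeval_fin_two, cann_cvar, cann_cvar, cform_zvec_zvec, cform_zvec_zbarvec, hinner]
    split_ifs <;> simp
  have hzb (k l : κ) (p : MvPolynomial (Fin 2) ℂ) : cann (zbarvec (e k)) (MvPolynomial.aeval
      ![cvar (zvec (e l)), cvar (zbarvec (e l))] p) =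
      if k = l then MvPolynomial.aeval ![cvar (zvec (e l)), cvar (zbarvec (e l))]
        (MvPolynomial.pderiv 0 p) else 0 := by
    rw [deriv_aeval_fin_two, cann_cvar, cann_cvar, cform_zbarvec_zbarvec, cform_comm,
      cform_zvec_zbarvec, hinner]
    split_ifs <;> simp
  induction N with
  | zero => simp [wick_zero, indexCount, hermitePoly]
  | succ N ih =>
    have ih' := ih (fun a => w a.succ) fun a => hs _
    rw [wick_succ]
    change raise cvar cann (letterVec e (w 0)) (wick cvar cann (letterVec e ∘ fun a => w a.succ)) = _
    rw [ih']
    have h0 := hs 0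
    rcases hw : w 0 with k₀ | k₀
    · replace h0 : k₀ ∈ s := by simpa [hw] using h0
      refine raise_prod _ _ _ _ _ h0 (fun k _ hk => ?_) ?_ fun k hk => ?_
      · exact (hz k₀ k _).trans (if_neg hk)
      · rw [indexCount_succ w, indexCount_succ w, hw, if_pos rfl, if_neg (by simp), add_zero,
          hermitePoly_succ_left, raise_apply]
        change _ = cvar (zvec (e k₀)) * _ - cann (zvec (e k₀)) _
        rw [hz, if_pos rfl, hermiteRaise]
        simp
      · have hk' : k ≠ k₀ := hk
        rw [indexCount_succ w, indexCount_succ w, hw, if_neg (by simpa using hk'),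
          if_neg (by simp), add_zero, add_zero]
    · replace h0 : k₀ ∈ s := by simpa [hw] using h0
      refine raise_prod _ _ _ _ _ h0 (fun k _ hk => ?_) ?_ fun k hk => ?_
      · exact (hzb k₀ k _).trans (if_neg (Ne.symm hk))
      · rw [indexCount_succ w, indexCount_succ w, hw, if_pos rfl, if_neg (by simp), add_zero,
          hermitePoly_succ_right, raise_apply]
        change _ = cvar (zbarvec (e k₀)) * _ - cann (zbarvec (e k₀)) _
        rw [hzb, if_pos rfl, hermiteRaiseBar]
        simp
      · have hk' : k ≠ k₀ := hk
        rw [indexCount_succ w, indexCount_succ w, hw, if_neg (by simp),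
          if_neg (by simpa using hk'), add_zero, add_zero]

end Letters

/-! ### Complex Fourier-Hermite polynomials as Wick products of words -/

section ComplexIntegral

variable {Ω : Type*} [MeasurableSpace Ω] {P : Measure Ω}
variable {H : Type*} [NormedAddCommGroup H] [InnerProductSpace ℝ H] {X Y : H → Ω → ℝ}

lemma evalProcess_zvec (hX : IsIsonormal P X) (hY : IsIsonormal P Y)
    (hXY : IndepFun (fun ω h => X h ω) (fun ω h => Y h ω) P) (h : Complexification H) :
    ∀ᵐ ω ∂P, evalProcess (directSumProcess X Y) (cvar (zvec h)) ω = complexProcess X Y h ω ∧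
      evalProcess (directSumProcess X Y) (cvar (zbarvec h)) ω =
        starRingEnd ℂ (complexProcess X Y h ω) := by
  have hW := hX.directSum hY hXY
  -- Linearity of `W` and `Y` holds only almost surely, with an exceptional set for each relation;
  -- these are the relations used, each with a zero second summand.
  filter_upwards [hW.smul_add_smul (√2)⁻¹ 0 (WithLp.toLp 2 (h.re, -h.im)) 0,
    hW.smul_add_smul (√2)⁻¹ 0 (WithLp.toLp 2 (h.im, h.re)) 0,
    hW.smul_add_smul (-1) 0 ((√2)⁻¹ • WithLp.toLp 2 (h.im, h.re)) 0,
    hY.smul_add_smul (-1) 0 h.im 0] with ω h₁ h₂ h₃ h₄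
  simp only [smul_zero, add_zero, zero_mul, neg_one_smul, neg_one_mul] at h₁ h₂ h₃ h₄
  have e₁ : directSumProcess X Y (zvec h).1 ω = (√2)⁻¹ * (X h.re ω - Y h.im ω) := by
    rw [zvec, h₁, directSumProcess]
    simp [h₄, sub_eq_add_neg]
  have e₂ : directSumProcess X Y (zvec h).2 ω = (√2)⁻¹ * (X h.im ω + Y h.re ω) := by
    rw [zvec, h₂, directSumProcess]
    rfl
  have e₃ : directSumProcess X Y ((-1 : ℝ) • (zvec h).2) ω = -((√2)⁻¹ * (X h.im ω + Y h.re ω)) := by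
    rw [← e₂, neg_one_smul]
    exact h₃
  constructor
  · simp only [evalProcess, cvar, map_add, map_mul, MvPolynomial.eval_X, MvPolynomial.eval_C, e₁, e₂,
      complexProcess]
    push_cast
    rw [div_eq_inv_mul]
    linear_combination (-((√2 : ℝ) : ℂ)⁻¹ * (Y h.im ω : ℝ)) * Complex.I_sq
  · simp only [evalProcess, cvar, zbarvec, map_add, map_mul, MvPolynomial.eval_X,
      MvPolynomial.eval_C, e₁, e₃, complexProcess, map_div₀, Complex.conj_I, Complex.conj_ofReal]
    push_cast
    rw [div_eq_inv_mul]
    linear_combination (-((√2 : ℝ) : ℂ)⁻¹ * (Y h.im ω : ℝ)) * Complex.I_sq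

lemma complexFourierHermite_eq (hX : IsIsonormal P X) (hY : IsIsonormal P Y)
    (hXY : IndepFun (fun ω h => X h ω) (fun ω h => Y h ω) P) {κ : Type*}
    {e : κ → Complexification H} (he : Orthonormal ℂ e) {m n : ℕ} (i : Fin m → κ)
    (j : Fin n → κ) :
    complexFourierHermite X Y e i j =ᵐ[P] evalProcess (directSumProcess X Y)
      (wick cvar cann (letterVec e ∘ word i j)) := by
  classical
  set s := Finset.univ.image i ∪ Finset.univ.image j with hs
  -- Only finitely many basis vectors occur, so the exceptional null sets can be united.
  have hae : ∀ᵐ ω ∂P, ∀ k ∈ s,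
      evalProcess (directSumProcess X Y) (cvar (zvec (e k))) ω = complexProcess X Y (e k) ω ∧
      evalProcess (directSumProcess X Y) (cvar (zbarvec (e k))) ω =
        starRingEnd ℂ (complexProcess X Y (e k) ω) :=
    (Filter.eventually_all_finset s).mpr fun k _ => evalProcess_zvec hX hY hXY (e k)
  filter_upwards [hae] with ω hω
  rw [wick_letterVec he (word i j) s, complexFourierHermite, evalProcess, map_prod]
  · refine Finset.prod_congr (by rw [hs]) fun k hk => ?_
    rw [complexHermite_two, indexCount_word_inl, indexCount_word_inr, evalConj]
    obtain ⟨h₁, h₂⟩ := hω k hk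
    rw [← h₂, ← h₁]
    simp only [evalProcess]
    induction hermitePoly (indexCount i k) (indexCount j k) using MvPolynomial.induction_on with
    | C c => simp
    | add p q hp hq => simp only [map_add, hp, hq]
    | mul_X p l hp =>
      rw [map_mul, map_mul, map_mul, hp]
      fin_cases l <;> simp
  · intro a
    rw [word, Function.comp_apply]
    rcases finSumFinEquiv.symm a with b | b <;> simp [hs]

/-- The products of two complex Wick products of the same type `(m, n)`, `m ≠ n`, are centered. -/
lemma integral_wick_letterVec_mul {W : WithLp 2 (H × H) → Ω → ℝ} (hW : IsIsonormal P W)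
    {κ : Type*} (e : κ → Complexification H) {m n : ℕ} (hmn : m ≠ n) (i i' : Fin m → κ)
    (j j' : Fin n → κ) :
    ∫ ω, evalProcess W (wick cvar cann (letterVec e ∘ word i j)) ω *
      evalProcess W (wick cvar cann (letterVec e ∘ word i' j')) ω ∂P = 0 := by
  have key := expect_wick_mul_wick (B := cform) (x := (cvar (K := WithLp 2 (H × H)))) (D := cann)
    cann_cvar cann_comm (expect hW) (expect_one hW) (expect_cvar_mul hW)
    (letterVec e ∘ word i j) (letterVec e ∘ word i' j')
  have := key.trans (sum_perm_cform_eq_zero e hmn i i' j j')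
  rw [expect_apply] at this
  simpa [evalProcess] using this

end ComplexIntegral

/-! ### Closed subspaces, real and imaginary parts, and the pseudo-variance -/

section ComplexIntegral

variable {Ω : Type*} [MeasurableSpace Ω] {P : Measure Ω}
variable {H : Type*} [NormedAddCommGroup H] [InnerProductSpace ℝ H] {X Y : H → Ω → ℝ}

/-- Reduces a closed linear condition on the integral to Wick products of words. Convergence need
not be checked, since the default value `0` of a divergent `tsum` also lies in `S`. -/
lemma complexIntegral_mem (hX : IsIsonormal P X) (hY : IsIsonormal P Y)
    (hXY : IndepFun (fun ω h => X h ω) (fun ω h => Y h ω) P) {κ : Type*}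
    (e : HilbertBasis κ ℂ (Complexification H)) (m n : ℕ)
    (φ : SymPowerTensor ℂ (Complexification H) m n) (S : Submodule ℂ (Lp ℂ 2 P))
    (hS : IsClosed (S : Set (Lp ℂ 2 P)))
    (h : ∀ (i : Fin m → κ) (j : Fin n → κ),
      toL2 (hX.directSum hY hXY) (wick cvar cann (letterVec e ∘ word i j)) ∈ S) :
    complexIntegral hX hY e m n φ ∈ S := by
  rw [complexIntegral]
  refine tsum_mem hS fun ij => Submodule.smul_mem _ _ ?_
  convert h ij.1 ij.2 using 1
  exact MemLp.toLp_congr _ (memLp_evalProcess (hX.directSum hY hXY) _)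
    (complexFourierHermite_eq hX hY hXY e.orthonormal ij.1 ij.2)

/-- The real part of a square integrable function. -/
def reL2 : Lp ℂ 2 P →L[ℝ] Lp ℝ 2 P := ContinuousLinearMap.compLpL 2 P Complex.reCLM

/-- The imaginary part of a square integrable function. -/
def imL2 : Lp ℂ 2 P →L[ℝ] Lp ℝ 2 P := ContinuousLinearMap.compLpL 2 P Complex.imCLM

/-- The complex conjugate of a square integrable function. -/
def conjL2 : Lp ℂ 2 P →L[ℝ] Lp ℂ 2 P :=
  ContinuousLinearMap.compLpL 2 P (Complex.conjCLE : ℂ →L[ℝ] ℂ)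

lemma coeFn_reL2 (F : Lp ℂ 2 P) : reL2 F =ᵐ[P] fun ω => (F ω).re :=
  ContinuousLinearMap.coeFn_compLpL _ F

lemma coeFn_imL2 (F : Lp ℂ 2 P) : imL2 F =ᵐ[P] fun ω => (F ω).im :=
  ContinuousLinearMap.coeFn_compLpL _ F

lemma coeFn_conjL2 (F : Lp ℂ 2 P) : conjL2 F =ᵐ[P] fun ω => starRingEnd ℂ (F ω) :=
  ContinuousLinearMap.coeFn_compLpL _ F

/-- Writes the bilinear moment `E[F G]` as an inner product, so that its vanishing defines a closed
orthogonal complement. -/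
lemma inner_conjL2 (F G : Lp ℂ 2 P) : inner ℂ (conjL2 F) G = ∫ ω, F ω * G ω ∂P := by
  rw [L2.inner_def]
  refine integral_congr_ae ?_
  filter_upwards [coeFn_conjL2 F] with ω h
  rw [h]
  simp [mul_comm]

lemma reL2_smul (c : ℂ) (F : Lp ℂ 2 P) : reL2 (c • F) = c.re • reL2 F - c.im • imL2 F := by
  refine Lp.ext ?_
  filter_upwards [coeFn_reL2 (c • F), coeFn_reL2 F, coeFn_imL2 F, Lp.coeFn_smul c F,
    Lp.coeFn_sub (c.re • reL2 F) (c.im • imL2 F), Lp.coeFn_smul c.re (reL2 F),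
    Lp.coeFn_smul c.im (imL2 F)] with ω h₁ h₂ h₃ h₄ h₅ h₆ h₇
  rw [h₁, h₅, Pi.sub_apply, h₄, h₆, h₇]
  simp [h₂, h₃]

lemma imL2_smul (c : ℂ) (F : Lp ℂ 2 P) : imL2 (c • F) = c.re • imL2 F + c.im • reL2 F := by
  refine Lp.ext ?_
  filter_upwards [coeFn_imL2 (c • F), coeFn_reL2 F, coeFn_imL2 F, Lp.coeFn_smul c F,
    Lp.coeFn_add (c.re • imL2 F) (c.im • reL2 F), Lp.coeFn_smul c.re (imL2 F),
    Lp.coeFn_smul c.im (reL2 F)] with ω h₁ h₂ h₃ h₄ h₅ h₆ h₇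
  rw [h₁, h₅, Pi.add_apply, h₄, h₆, h₇]
  simp [h₂, h₃]

/-- The complex functions whose real and imaginary parts belong to a real subspace. -/
def complexSpan (R : Submodule ℝ (Lp ℝ 2 P)) : Submodule ℂ (Lp ℂ 2 P) where
  carrier := {F | reL2 F ∈ R ∧ imL2 F ∈ R}
  zero_mem' := by simp
  add_mem' hF hG := by
    simp only [Set.mem_ofPred_eq, map_add]
    exact ⟨add_mem hF.1 hG.1, add_mem hF.2 hG.2⟩
  smul_mem' c F hF := by
    simp only [Set.mem_ofPred_eq, reL2_smul, imL2_smul]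
    exact ⟨sub_mem (R.smul_mem _ hF.1) (R.smul_mem _ hF.2),
      add_mem (R.smul_mem _ hF.2) (R.smul_mem _ hF.1)⟩

lemma isClosed_complexSpan {R : Submodule ℝ (Lp ℝ 2 P)} (hR : IsClosed (R : Set (Lp ℝ 2 P))) :
    IsClosed (complexSpan R : Set (Lp ℂ 2 P)) :=
  (hR.preimage reL2.continuous).inter (hR.preimage imL2.continuous)

lemma toL2_wickPoly_mem_complexSpan {K : Type*} [NormedAddCommGroup K] [InnerProductSpace ℝ K]
    {W : K → Ω → ℝ} (hW : IsIsonormal P W) {m : ℕ} (f : Fin m → K) {R : Submodule ℝ (Lp ℝ 2 P)}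
    (hf : toL2 hW (wickPoly ℝ f) ∈ R) : toL2 hW (wickPoly ℂ f) ∈ complexSpan R := by
  have h₁ : reL2 (toL2 hW (wickPoly ℂ f)) = toL2 hW (wickPoly ℝ f) := by
    refine Lp.ext ?_
    filter_upwards [coeFn_reL2 (toL2 hW (wickPoly ℂ f)), coeFn_toL2 hW (wickPoly ℂ f),
      coeFn_toL2 hW (wickPoly ℝ f)] with ω h₁ h₂ h₃
    rw [h₁, h₂, h₃, evalProcess_wickPoly, Complex.ofReal_re]
  have h₂ : imL2 (toL2 hW (wickPoly ℂ f)) = 0 := by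
    refine Lp.ext ?_
    filter_upwards [coeFn_imL2 (toL2 hW (wickPoly ℂ f)), coeFn_toL2 hW (wickPoly ℂ f),
      Lp.coeFn_zero ℝ 2 P] with ω h₁ h₂ h₃
    rw [h₁, h₂, h₃, evalProcess_wickPoly, Complex.ofReal_im, Pi.zero_apply]
  exact ⟨h₁ ▸ hf, h₂ ▸ R.zero_mem⟩

/-- As `m! ≥ 1`, `T` does not decrease norms; it is therefore antilipschitz on a complete space. -/
lemma isClosed_range_integral {K : Type*} [NormedAddCommGroup K] [InnerProductSpace ℝ K] {m : ℕ}
    {T : SymPower ℝ K m →L[ℝ] Lp ℝ 2 P}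
    (hT : ∀ u v, inner ℝ (T u) (T v) = m.factorial * inner ℝ u v) :
    IsClosed (LinearMap.range (T : SymPower ℝ K m →ₗ[ℝ] Lp ℝ 2 P) : Set (Lp ℝ 2 P)) := by
  have hb (u : SymPower ℝ K m) : ‖u‖ ≤ (1 : NNReal) * ‖T u‖ := by
    have h := hT u u
    rw [real_inner_self_eq_norm_sq, real_inner_self_eq_norm_sq] at h
    have h1 : (1 : ℝ) ≤ m.factorial := by exact_mod_cast m.factorial_pos
    rw [NNReal.coe_one, one_mul]
    refine (sq_le_sq₀ (norm_nonneg _) (norm_nonneg _)).mp ?_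
    rw [h]
    nlinarith [sq_nonneg ‖u‖]
  rw [LinearMap.coe_range]
  exact (AddMonoidHomClass.antilipschitz_of_bound T hb).isClosed_range T.uniformContinuous

/-- The complex integral has vanishing pseudo-variance if `m ≠ n`. -/
lemma integral_complexIntegral_mul_self (hX : IsIsonormal P X) (hY : IsIsonormal P Y)
    (hXY : IndepFun (fun ω h => X h ω) (fun ω h => Y h ω) P) {κ : Type*}
    (e : HilbertBasis κ ℂ (Complexification H)) {m n : ℕ} (hmn : m ≠ n)
    (φ : SymPowerTensor ℂ (Complexification H) m n) :
    ∫ ω, complexIntegral hX hY e m n φ ω * complexIntegral hX hY e m n φ ω ∂P = 0 := by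
  set F := complexIntegral hX hY e m n φ with hF
  -- If `E[G ·]` vanishes on all words of type `(m, n)`, it vanishes on `F`. This is used twice,
  -- once for each factor of `F * F`.
  have hmem (G : Lp ℂ 2 P) (h : ∀ (i : Fin m → κ) (j : Fin n → κ),
      inner ℂ (conjL2 G) (toL2 (hX.directSum hY hXY)
        (wick cvar cann (letterVec e ∘ word i j))) = 0) : inner ℂ (conjL2 G) F = 0 := by
    have := complexIntegral_mem hX hY hXY e m n φ (ℂ ∙ conjL2 G)ᗮ
      (Submodule.isClosed_orthogonal _)
      fun i j => Submodule.mem_orthogonal_singleton_iff_inner_right.mpr (h i j)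
    exact Submodule.mem_orthogonal_singleton_iff_inner_right.mp this
  rw [← inner_conjL2]
  refine hmem F fun i j => ?_
  rw [inner_conjL2]
  simp only [mul_comm (F _)]
  rw [← inner_conjL2]
  refine hmem _ fun i' j' => ?_
  rw [inner_conjL2, ← integral_wick_letterVec_mul (hX.directSum hY hXY) e hmn i i' j j']
  refine integral_congr_ae ?_
  filter_upwards [coeFn_toL2 (hX.directSum hY hXY) (wick cvar cann (letterVec e ∘ word i j)),
    coeFn_toL2 (hX.directSum hY hXY) (wick cvar cann (letterVec e ∘ word i' j'))] with ω h₁ h₂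
  rw [h₁, h₂]

lemma integral_add_I_mul_sq (U V : Lp ℝ 2 P) :
    ∫ ω, ((U ω : ℂ) + Complex.I * V ω) * ((U ω : ℂ) + Complex.I * V ω) ∂P =
      ((inner ℝ U U - inner ℝ V V : ℝ) : ℂ) + Complex.I * (2 * inner ℝ U V : ℝ) := by
  have hi (A B : Lp ℝ 2 P) : Integrable (fun ω => A ω * B ω) P :=
    (Lp.memLp A).integrable_mul (Lp.memLp B)
  have hin (A B : Lp ℝ 2 P) : inner ℝ A B = ∫ ω, A ω * B ω ∂P := by
    rw [L2.inner_def]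
    simp [mul_comm]
  have e : (fun ω => ((U ω : ℂ) + Complex.I * V ω) * ((U ω : ℂ) + Complex.I * V ω)) =
      fun ω => ((U ω * U ω - V ω * V ω : ℝ) : ℂ) + Complex.I * ((2 * (U ω * V ω) : ℝ) : ℂ) := by
    ext ω
    push_cast
    linear_combination (V ω : ℂ) * V ω * Complex.I_mul_I
  have i₁ : Integrable (fun ω => ((U ω * U ω - V ω * V ω : ℝ) : ℂ)) P :=
    ((hi U U).sub (hi V V)).ofReal
  have i₂ : Integrable (fun ω => Complex.I * ((2 * (U ω * V ω) : ℝ) : ℂ)) P :=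
    (((hi U V).const_mul 2).ofReal).const_mul Complex.I
  rw [e, integral_add i₁ i₂, integral_const_mul, integral_complex_ofReal, integral_complex_ofReal,
    integral_sub (hi U U) (hi V V), integral_const_mul, hin, hin, hin]

end ComplexIntegral

end WienerIto

end

/-! ### The theorem -/

open WienerIto
theorem theorem3p3 {H Ω : Type*} [NormedAddCommGroup H] [InnerProductSpace ℝ H] [CompleteSpace H]
    [TopologicalSpace.SeparableSpace H] [MeasurableSpace Ω] {P : Measure Ω}
    [IsProbabilityMeasure P] {X Y : H → Ω → ℝ} (hX : IsIsonormal P X) (hY : IsIsonormal P Y)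
    (hXY : IndepFun (fun ω h => X h ω) (fun ω h => Y h ω) P)
    {ι : Type*} (e : HilbertBasis ι ℂ (Complexification H)) (m n : ℕ)
    (φ : SymPowerTensor ℂ (Complexification H) m n) (U V : Ω → ℝ)
    (hF : ∀ᵐ ω ∂P, complexIntegral hX hY e m n φ ω = U ω + Complex.I * V ω) :
    ∃ u v : SymPower ℝ (WithLp 2 (H × H)) (m + n),
      (∀ (κ : Type*) (c : HilbertBasis κ ℝ (WithLp 2 (H × H))),
        U =ᵐ[P] realIntegral (hX.directSum hY hXY) c (m + n) u ∧
        V =ᵐ[P] realIntegral (hX.directSum hY hXY) c (m + n) v) ∧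
      (m ≠ n →
        ∫ ω, U ω ^ 2 ∂P = ∫ ω, V ω ^ 2 ∂P ∧
        ∫ ω, U ω * V ω ∂P = (m + n).factorial * inner ℝ u v ∧
        (m + n).factorial * inner ℝ u v = (0 : ℝ)) := by
  set hW := hX.directSum hY hXY
  obtain ⟨T, hT, hT'⟩ := exists_integral hW (m + n)
  -- The kernels are preimages under `T` of the real and imaginary parts of `F`; they are chosen
  -- before any basis `c`.
  obtain ⟨⟨u, hu⟩, ⟨v, hv⟩⟩ := complexIntegral_mem hX hY hXY e m n φ
    (complexSpan (LinearMap.range (T : SymPower ℝ (WithLp 2 (H × H)) (m + n) →ₗ[ℝ] Lp ℝ 2 P)))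
    (isClosed_complexSpan (isClosed_range_integral hT')) fun i j => by
      have hle : Submodule.span ℂ (Set.range fun f : Fin (m + n) → WithLp 2 (H × H) =>
          wickPoly ℂ f) ≤ (complexSpan (LinearMap.range
            (T : SymPower ℝ (WithLp 2 (H × H)) (m + n) →ₗ[ℝ] Lp ℝ 2 P))).comap (toL2 hW) := by
        refine Submodule.span_le.mpr ?_
        rintro _ ⟨f, rfl⟩
        exact toL2_wickPoly_mem_complexSpan hW f ⟨_, hT f⟩
      exact hle (wick_cvar_mem_span _)
  have hU : U =ᵐ[P] T u := by
    rw [show T u = _ from hu]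
    filter_upwards [hF, coeFn_reL2 (complexIntegral hX hY e m n φ)] with ω h₁ h₂
    rw [h₂, h₁]
    simp
  have hV : V =ᵐ[P] T v := by
    rw [show T v = _ from hv]
    filter_upwards [hF, coeFn_imL2 (complexIntegral hX hY e m n φ)] with ω h₁ h₂
    rw [h₂, h₁]
    simp
  have hin (a b : SymPower ℝ (WithLp 2 (H × H)) (m + n)) :
      inner ℝ (T a) (T b) = ∫ ω, T a ω * T b ω ∂P := by
    rw [L2.inner_def]
    simp [mul_comm]
  refine ⟨u, v, fun κ c => ?_, fun hmn => ?_⟩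
  · rw [realIntegral_eq hW hT, realIntegral_eq hW hT]
    exact ⟨hU, hV⟩
  have h0 := integral_complexIntegral_mul_self hX hY hXY e hmn φ
  -- The vanishing of `E[F²]`, whose real part is `E[U²] - E[V²]` and whose imaginary part is `2
  -- E[UV]`.
  have h1 : ∫ ω, ((T u ω : ℂ) + Complex.I * T v ω) * ((T u ω : ℂ) + Complex.I * T v ω) ∂P = 0 := by
    rw [← h0]
    refine integral_congr_ae ?_
    filter_upwards [hF, hU, hV] with ω h₁ h₂ h₃
    rw [h₁, h₂, h₃]
  rw [integral_add_I_mul_sq, Complex.ext_iff] at h1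
  simp only [Complex.add_re, Complex.ofReal_re, Complex.mul_re, Complex.I_re, Complex.I_im,
    Complex.ofReal_im, Complex.add_im, Complex.mul_im, Complex.zero_re, Complex.zero_im] at h1
  have hUV : ∫ ω, U ω * V ω ∂P = inner ℝ (T u) (T v) := by
    rw [hin]
    refine integral_congr_ae ?_
    filter_upwards [hU, hV] with ω h₂ h₃
    rw [h₂, h₃]
  have hUU : ∫ ω, U ω ^ 2 ∂P = inner ℝ (T u) (T u) := by
    rw [hin]
    refine integral_congr_ae ?_
    filter_upwards [hU] with ω h₂
    rw [h₂, sq]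
  have hVV : ∫ ω, V ω ^ 2 ∂P = inner ℝ (T v) (T v) := by
    rw [hin]
    refine integral_congr_ae ?_
    filter_upwards [hV] with ω h₃
    rw [h₃, sq]
  refine ⟨?_, ?_, ?_⟩
  · rw [hUU, hVV]; linarith [h1.1]
  · rw [hUV, hT']
  · rw [← hT']; linarith [h1.2]
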